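/- Let $g_{S^2}$ be the standard round metric on the unit sphere $S^2\subset\mathbb R^3$, and let $\nabla,\Delta,|\cdot|,\langle\cdot,\cdot\rangle,\operatorname{tr}$ be its Levi-Civita connection, Laplacian, tensor norm, inner product and trace. Let $I\subset\mathbb R$ be an open set of times (for instance an open interval) and let $v:S^2\times I\to(0,\infty)$ be smooth and such that the metrics $g(t)=v(\cdot,t)^{-1}g_{S^2}$ solve the Ricci flow $\partial_t g=-2\operatorname{Ric}(g)$; let $R$ be the scalar curvature of $g(t)$. For functions and tensors at a fixed time define: - $b=S(\nabla^3v)$, where $S(\alpha)(X,Y,Z)=\frac13\big(\alpha(X,Y,Z)+\alpha(Y,Z,X)+\alpha(Z,X,Y)\big)$, and its trace-free part $$\operatorname{TF}(b)(X,Y,Z)=b(X,Y,Z)-\big(z(X)\langle Y,Z\rangle+z(Y)\langle Z,X\rangle+z(Z)\langle X,Y\rangle\big),\qquad z=\tfrac14\operatorname{tr}^{2,3}b;$$ - $\operatorname{TF}(\alpha)=\alpha-\frac12(\operatorname{tr}\alpha)\,g_{S^2}$ for a symmetric $2$-tensor $\alpha$; - for a $4$-tensor $c$ symmetric and trace-free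 in its last three slots, the totally trace-free tensor $\mathring c$ given by $$\begin{aligned}c(W,X,Y,Z)=\mathring c(W,X,Y,Z)&+\langle W,X\rangle e(Y,Z)+\langle W,Y\rangle e(Z,X)+\langle W,Z\rangle e(X,Y)\\&+\langle Y,Z\rangle f(X,W)+\langle Z,X\rangle f(Y,W)+\langle X,Y\rangle f(Z,W),\end{aligned}$$ where $e=\frac13\operatorname{tr}^{1,2}c=-2f$. Put $Q=v|\operatorname{TF}(b)|^2$. Then on $S^2\times I$ $$\frac{\partial Q}{\partial t}=v\Delta Q-4RQ-2\big|\big(v\nabla\operatorname{TF}(b)+2\,dv\otimes\operatorname{TF}(b)\big)^{\circ}\big|^2-\tfrac12\big|v\operatorname{TF}\big(\nabla^2(\Delta v+6v)\big)-2\operatorname{tr}^{1,2}\big(dv\otimes\operatorname{TF}(b)\big)\big|^2 .$$ In particular $\partial_tQ\le v\Delta Q-4RQ$. Moreover, for every $\mu>0$ and every unit vector $n\in S^2$, the King–Rosenau metrics $g(t)=v(\cdot,t)^{-1}g_{S^2}$, $t<0$, with $$v(x,t)=-\mu\coth(2\mu t)+\mu\tanh(2\mu t)\,\langle n,x\rangle^2,$$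 are such a solution (with $I=(-\infty,0)$, $v$ smooth and positive), and for them $Q\equiv0$. -/

import Mathlib

open scoped Manifold ContDiff RealInnerProductSpace

noncomputable section

namespace SphereFlow

/-- Euclidean three-space. -/
abbrev E3 : Type := EuclideanSpace ℝ (Fin 3)

/-- The unit sphere `S²`, with its standard smooth structure. -/
abbrev S2 : Type := Metric.sphere (0 : E3) 1

/-- The tangent plane of `S²` at `x`, as the plane `x^⊥` in Euclidean space. Its inner product
is the standard round metric `g_{S²}`. -/
abbrev Tan (x : S2) : Type := ((ℝ ∙ (x : E3))ᗮ : Submodule ℝ E3)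

/-- Orthogonal projection of Euclidean space onto the tangent plane at `x`. -/
def proj (x : S2) : E3 →L[ℝ] Tan x := (ℝ ∙ (x : E3))ᗮ.orthogonalProjectionOnto

theorem fact_finrank_E3 : Fact (Module.finrank ℝ E3 = 2 + 1) := ⟨by simp⟩

/-- An orthonormal basis of the tangent plane at `x`. -/
def frame (x : S2) : OrthonormalBasis (Fin 2) ℝ (Tan x) :=
  haveI := fact_finrank_E3
  OrthonormalBasis.fromOrthogonalSpanSingleton 2 (ne_zero_of_mem_unit_sphere x)

/-- Radial projection `y ↦ y / ‖y‖` of punctured Euclidean space onto `S²` (the value at `0` is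
irrelevant). -/
def radial (y : E3) : S2 :=
  if h : y = 0 then ⟨EuclideanSpace.single 0 1, by simp⟩
  else ⟨‖y‖⁻¹ • y, by simp [norm_smul, h]⟩

/-! ### Covariant tensor calculus of the round sphere -/

/-- Covariant `k`-tensor fields on `S²`, as functions of a point and of `k` tangent vectors. -/
abbrev TensorField (k : ℕ) : Type := (x : S2) → (Fin k → Tan x) → ℝ

/-- Functions are `0`-tensors. -/
def ofFun (f : S2 → ℝ) : TensorField 0 := fun x _ => f x

/-- The Levi-Civita covariant derivative of the round metric, with the direction of
differentiation in the first slot: `(∇T)(W, X₁, …, X_k) = (∇_W T)(X₁, …, X_k)`.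
The arguments `X_i`, tangent at `x`, are extended to the tangent fields `y ↦ proj y X_i`, whose
covariant derivatives (the tangential parts of their Euclidean derivatives) vanish at `x`; so
`(∇_W T)(X₁, …, X_k)` is the derivative along `W` of the function
`y ↦ T_y(proj y X₁, …, proj y X_k)` on the sphere, which is computed through its radially constant
extension. -/
def nabla {k : ℕ} (T : TensorField k) : TensorField (k + 1) := fun x X =>
  fderiv ℝ (fun y : E3 => T (radial y) (fun i => proj (radial y) (X i.succ : E3))) x (X 0 : E3)

/-- Trace over the first two slots, with respect to the round metric. -/
def tr12 {k : ℕ} (T : TensorField (k + 2)) : TensorField k := fun x X =>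
  ∑ i, T x (Fin.cons (frame x i) (Fin.cons (frame x i) X))

/-- Trace of a `3`-tensor over its last two slots, with respect to the round metric. -/
def tr23 (T : TensorField 3) : TensorField 1 := fun x X =>
  ∑ i, T x ![X 0, frame x i, frame x i]

/-- The squared norm `|T|²` with respect to the round metric. -/
def normSq {k : ℕ} (T : TensorField k) (x : S2) : ℝ :=
  ∑ J : Fin k → Fin 2, (T x (fun a => frame x (J a))) ^ 2

/-- The Hessian `∇²f`. -/
def hess (f : S2 → ℝ) : TensorField 2 := nabla (nabla (ofFun f))

/-- The Laplacian `Δf = tr ∇²f` of the round metric. -/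
def lap (f : S2 → ℝ) (x : S2) : ℝ := tr12 (hess f) x ![]

/-- Tensor product of a `1`-tensor (first slot) with a `k`-tensor. -/
def tmul {k : ℕ} (w : TensorField 1) (T : TensorField k) : TensorField (k + 1) := fun x X =>
  w x ![X 0] * T x (fun i => X i.succ)

/-- The symmetrization `S(α)` of a `3`-tensor which is symmetric in its last two slots. -/
def symm3 (α : TensorField 3) : TensorField 3 := fun x X =>
  (1 / 3) * (α x ![X 0, X 1, X 2] + α x ![X 1, X 2, X 0] + α x ![X 2, X 0, X 1])

/-- The trace-free part of a symmetric `2`-tensor. -/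
def TF2 (α : TensorField 2) : TensorField 2 := fun x X =>
  α x X - (1 / 2) * tr12 α x ![] * ⟪X 0, X 1⟫

/-- The trace-free part of a symmetric `3`-tensor `b`: the tensor
`b(X,Y,Z) - (z(X)⟨Y,Z⟩ + z(Y)⟨Z,X⟩ + z(Z)⟨X,Y⟩)` with `z = tr^{2,3} b / 4`. -/
def TF3 (b : TensorField 3) : TensorField 3 := fun x X =>
  let z : Tan x → ℝ := fun Y => (1 / 4) * tr23 b x ![Y]
  b x X - (z (X 0) * ⟪X 1, X 2⟫ + z (X 1) * ⟪X 2, X 0⟫ + z (X 2) * ⟪X 0, X 1⟫)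

/-- The totally trace-free part `c°` of a `4`-tensor `c` which is symmetric and trace-free in its
last three slots `X, Y, Z`:
`c(W,X,Y,Z) = c°(W,X,Y,Z) + ⟨W,X⟩e(Y,Z) + ⟨W,Y⟩e(Z,X) + ⟨W,Z⟩e(X,Y)`
`+ ⟨Y,Z⟩f(X,W) + ⟨Z,X⟩f(Y,W) + ⟨X,Y⟩f(Z,W)` with `e = tr^{1,2} c / 3 = -2 f`. -/
def ring4 (c : TensorField 4) : TensorField 4 := fun x V =>
  let e : Tan x → Tan x → ℝ := fun Y Z => (1 / 3) * tr12 c x ![Y, Z]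
  let f : Tan x → Tan x → ℝ := fun Y Z => -(1 / 2) * e Y Z
  let W := V 0
  let X := V 1
  let Y := V 2
  let Z := V 3
  c x V - (⟪W, X⟫ * e Y Z + ⟪W, Y⟫ * e Z X + ⟪W, Z⟫ * e X Y
    + ⟪Y, Z⟫ * f X W + ⟪Z, X⟫ * f Y W + ⟪X, Y⟫ * f Z W)

/-- `TF(b)`, where `b = S(∇³v)`. -/
def TFb (v : S2 → ℝ) : TensorField 3 := TF3 (symm3 (nabla (hess v)))

/-- The quantity `Q = v |TF(b)|²`. -/
def Q (v : S2 → ℝ) (x : S2) : ℝ := v x * normSq (TFb v) x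

/-- The totally trace-free part of `v ∇TF(b) + 2 dv ⊗ TF(b)`. -/
def gradTerm (v : S2 → ℝ) : TensorField 4 :=
  ring4 (fun x X => v x * nabla (TFb v) x X + 2 * tmul (nabla (ofFun v)) (TFb v) x X)

/-- The `2`-tensor `v TF(∇²(Δv + 6v)) - 2 tr^{1,2}(dv ⊗ TF(b))`. -/
def hessTerm (v : S2 → ℝ) : TensorField 2 := fun x X =>
  v x * TF2 (hess (fun y => lap v y + 6 * v y)) x X
    - 2 * tr12 (tmul (nabla (ofFun v)) (TFb v)) x X

/-! ### Curvature of a metric on `S²` and the Ricci flow -/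

/-- The coordinate plane. -/
abbrev E2 : Type := EuclideanSpace ℝ (Fin 2)

/-- Partial derivative in the direction of the `i`-th coordinate. -/
def pd (i : Fin 2) (f : E2 → ℝ) (u : E2) : ℝ := fderiv ℝ f u (EuclideanSpace.single i 1)

/-- The Christoffel symbols `Γ^k_{ij}` of a metric `G_{ij}` given in coordinates. -/
def christoffel (G : E2 → Matrix (Fin 2) (Fin 2) ℝ) (k i j : Fin 2) (u : E2) : ℝ :=
  (1 / 2) * ∑ l, (G u)⁻¹ k l *
    (pd i (fun w => G w j l) u + pd j (fun w => G w i l) u - pd l (fun w => G w i j) u)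

/-- The components `R_{ij}` of the Ricci tensor of a metric `G_{ij}` given in coordinates. -/
def ricciCoord (G : E2 → Matrix (Fin 2) (Fin 2) ℝ) (i j : Fin 2) (u : E2) : ℝ :=
  ∑ k, (pd k (christoffel G k i j) u - pd j (christoffel G k i k) u)
    + ∑ k, ∑ l, (christoffel G k k l u * christoffel G l i j u
      - christoffel G k j l u * christoffel G l i k u)

/-- The standard coordinates of `S²` centred at `p` (stereographic projection from `-p`), as a
parametrization of the sphere minus `-p`. -/
def param (p : S2) (u : E2) : S2 := (chartAt E2 p).symm u

/-- The `i`-th coordinate vector field of these coordinates; the Euclidean derivative is already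
tangent to the sphere. -/
def coordVec (p : S2) (i : Fin 2) (u : E2) : Tan (param p u) :=
  proj (param p u) (fderiv ℝ (fun w => (param p w : E3)) u (EuclideanSpace.single i 1))

/-- The components of a Riemannian metric on `S²` in the standard coordinates centred at `p`. -/
def inCoord (h : TensorField 2) (p : S2) (u : E2) : Matrix (Fin 2) (Fin 2) ℝ :=
  Matrix.of fun i j => h (param p u) ![coordVec p i u, coordVec p j u]

/-- The components at `p` of the Ricci tensor of `h`, in the standard coordinates centred at
`p`. -/
def ricci (h : TensorField 2) (p : S2) (i j : Fin 2) : ℝ :=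
  ricciCoord (inCoord h p) i j (chartAt E2 p p)

/-- The scalar curvature of `h` at `p`. -/
def scal (h : TensorField 2) (p : S2) : ℝ :=
  ∑ i, ∑ j, (inCoord h p (chartAt E2 p p))⁻¹ i j * ricci h p i j

/-- The conformal metric `v⁻¹ g_{S²}`. -/
def confMetric (v : S2 → ℝ) : TensorField 2 := fun x X => (v x)⁻¹ * ⟪X 0, X 1⟫

/-- The metrics `g(t) = v(·,t)⁻¹ g_{S²}`, `t ∈ I`, with `v` positive and smooth in space and time,
form a solution of the Ricci flow `∂g/∂t = -2 Ric(g)` on `S²`. -/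
structure IsConformalRicciFlow (I : Set ℝ) (v : ℝ → S2 → ℝ) : Prop where
  pos : ∀ t ∈ I, ∀ x, 0 < v t x
  smooth : ContMDiffOn (𝓘(ℝ, ℝ).prod (𝓡 2)) 𝓘(ℝ, ℝ) ∞
    (fun z : ℝ × S2 => v z.1 z.2) (I ×ˢ Set.univ)
  flow : ∀ t ∈ I, ∀ p i j,
    HasDerivAt (fun s => inCoord (confMetric (v s)) p (chartAt E2 p p) i j)
      (-2 * ricci (confMetric (v t)) p i j) t

/-- The King–Rosenau solution with axis `n` and parameter `μ`: the metrics `v(·,t)⁻¹ g_{S²}`,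
`t < 0`, with `v(x,t) = -μ coth(2μt) + μ tanh(2μt) ⟨n,x⟩²`. -/
def kingRosenau (μ : ℝ) (n : S2) : ℝ → S2 → ℝ := fun t x =>
  -μ * (Real.cosh (2 * μ * t) / Real.sinh (2 * μ * t))
    + μ * Real.tanh (2 * μ * t) * ⟪(n : E3), (x : E3)⟫ ^ 2

end SphereFlow

end

open SphereFlow

/-!
The proof rests on a change of unknown. In the stereographic coordinates `u` centred at `p` the
round metric is `lam² |du|²`, so that `v⁻¹ g_{S²} = w⁻¹ |du|²` for the weighted function
`w = lam⁻² v` on the plane. In terms of `w` all conformal factors disappear: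

* the trace-free part of the third covariant derivative of `v` is, in coordinate components,
  `lam²` times that of the flat third derivative of `w` (`TFb_comp`). In the complex coordinate `z` this is Bol's lemma: `∂_z³` is an
  invariant operator on densities of weight `-1`. Hence `Q = 16 w |∂_z³ w|²`, which is `flatQ w`
  (`Q_weighted`);
* the Ricci flow is the equation `∂w/∂t = w Δw - |∇w|²` on the plane (`ricci_weighted`,
  `flow_weighted`), and the scalar curvature is `Δw - |∇w|² / w` (`scal_confMetric`).

Differentiating the flow equation, `B = ∂_z³ w` satisfies
`∂B/∂t = 4 (w B_{z z̄} + 2 w_z B_{z̄} - w_{z̄} B_z - 2 w_{z z̄} B)` (`thirdRe_flowRhs`,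
`thirdIm_flowRhs`). Inserting this into `∂Q/∂t - w ΔQ + 4 R Q` and completing squares leaves
`-64 (|w B_z + 2 w_z B|² + |w B_{z̄} - w_{z̄} B|²)`. The two squares are the two tensor norms of the
evolution equation (`normSq_gradTerm`, `normSq_hessTerm`), because the trace-free Hessian of
`Δv + 6v` is, at the centre, the trace-free flat Hessian of `Δw`. The identity is needed only at the
centre of the coordinates, since every point is the centre of its own coordinates
(`evolution_center`).

To compare tensor fields on the sphere with functions on the plane, the covariant derivative,
defined through radial extensions, is computed in the coordinates by the Christoffel symbols
(`nabla_param`, `D_coframe`), and traces and norms by the orthogonality of the frame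
(`sum_coframe_frame`). Real notation is used: `thirdRe w` and `thirdIm w` are the components of
`8 ∂_z³ w = thirdRe w - i thirdIm w`.

For the King–Rosenau metrics `w` is a polynomial of degree two in `z`, with coefficients depending on
`z̄` (`rosenauPoly`), so that `∂_z³ w = 0`.
-/

noncomputable section

namespace SphereFlow

/-! ### The ring of smooth functions on the plane -/

/-- The ring of smooth functions on the coordinate plane. -/
def Smooth : Subalgebra ℝ (E2 → ℝ) where
  carrier := {f | ContDiff ℝ ∞ f}
  mul_mem' hf hg := by
    simp only [Set.mem_ofPred_eq] at *
    exact hf.mul hg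
  add_mem' hf hg := by
    simp only [Set.mem_ofPred_eq] at *
    exact hf.add hg
  algebraMap_mem' r := by
    simp only [Set.mem_ofPred_eq]
    exact contDiff_const (c := r)

namespace Smooth

instance : CoeFun Smooth fun _ => E2 → ℝ := ⟨Subtype.val⟩

theorem mem_iff {f : E2 → ℝ} : f ∈ Smooth ↔ ContDiff ℝ ∞ f := Iff.rfl

theorem smooth (f : Smooth) : ContDiff ℝ ∞ f.1 := mem_iff.1 f.2

theorem diff (f : Smooth) : Differentiable ℝ f.1 := (smooth f).differentiable (by simp)

/-- The partial derivative in the direction of the `i`-th coordinate. -/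
def D (i : Fin 2) (f : Smooth) : Smooth :=
  ⟨pd i f.1, mem_iff.2 <| ((smooth f).fderiv_right (m := ∞) (by simp)).clm_apply contDiff_const⟩

/-- The constant function. -/
def C (r : ℝ) : Smooth := algebraMap ℝ Smooth r

/-- The `i`-th coordinate function. -/
def U (i : Fin 2) : Smooth := ⟨fun u => u i, mem_iff.2 (by fun_prop)⟩

theorem ext {f g : Smooth} (h : ∀ u, f u = g u) : f = g := Subtype.ext (funext h)

@[simp] theorem add_apply (f g : Smooth) (u : E2) : (f + g) u = f u + g u := rfl
@[simp] theorem sub_apply (f g : Smooth) (u : E2) : (f - g) u = f u - g u := rfl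
@[simp] theorem neg_apply (f : Smooth) (u : E2) : (-f) u = -f u := rfl
@[simp] theorem mul_apply (f g : Smooth) (u : E2) : (f * g) u = f u * g u := rfl
@[simp] theorem pow_apply (f : Smooth) (n : ℕ) (u : E2) : (f ^ n) u = f u ^ n := rfl
@[simp] theorem zero_apply (u : E2) : (0 : Smooth) u = 0 := rfl
@[simp] theorem one_apply (u : E2) : (1 : Smooth) u = 1 := rfl
@[simp] theorem C_apply (r : ℝ) (u : E2) : C r u = r := rfl
@[simp] theorem U_apply (i : Fin 2) (u : E2) : U i u = u i := rfl

theorem D_apply (i : Fin 2) (f : Smooth) (u : E2) : D i f u = pd i f u := rfl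

@[simp] theorem D_add (i : Fin 2) (f g : Smooth) : D i (f + g) = D i f + D i g := by
  ext u
  change fderiv ℝ (f.1 + g.1) u _ = _
  rw [fderiv_add (diff f u) (diff g u)]
  rfl

@[simp] theorem D_neg (i : Fin 2) (f : Smooth) : D i (-f) = -D i f := by
  ext u
  change fderiv ℝ (-f.1) u _ = _
  rw [fderiv_neg]
  rfl

@[simp] theorem D_sub (i : Fin 2) (f g : Smooth) : D i (f - g) = D i f - D i g := by
  rw [sub_eq_add_neg, D_add, D_neg, sub_eq_add_neg]

@[simp] theorem D_mul (i : Fin 2) (f g : Smooth) : D i (f * g) = D i f * g + f * D i g := by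
  ext u
  change fderiv ℝ (f.1 * g.1) u _ = _
  rw [fderiv_mul (diff f u) (diff g u)]
  simp [D_apply, pd]
  ring

@[simp] theorem D_C (i : Fin 2) (r : ℝ) : D i (C r) = 0 := by
  ext u
  change fderiv ℝ (fun _ => r) u _ = _
  simp

@[simp] theorem D_zero (i : Fin 2) : D i 0 = 0 := D_C i 0

@[simp] theorem D_one (i : Fin 2) : D i 1 = 0 := D_C i 1

theorem D_U (i j : Fin 2) : D i (U j) = C (if i = j then 1 else 0) := by
  ext u
  change fderiv ℝ (fun u : E2 => EuclideanSpace.proj (𝕜 := ℝ) j u) u _ = _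
  rw [ContinuousLinearMap.fderiv]
  simp [eq_comm]

@[simp] theorem D_U_same (i : Fin 2) : D i (U i) = 1 := by simp [D_U]; rfl
@[simp] theorem D_U_zero_one : D 0 (U 1) = 0 := by simp [D_U]; rfl
@[simp] theorem D_U_one_zero : D 1 (U 0) = 0 := by simp [D_U]; rfl

@[simp] theorem D_sq (i : Fin 2) (f : Smooth) : D i (f ^ 2) = C 2 * f * D i f := by
  ext u; simp [pow_two]; ring

theorem D_comm (i j : Fin 2) (f : Smooth) : D i (D j f) = D j (D i f) := by
  ext u
  have hd : DifferentiableAt ℝ (fderiv ℝ f.1) u :=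
    ((smooth f).fderiv_right (m := ∞) (by simp)).differentiable (by simp) u
  have key : ∀ a b : Fin 2, D a (D b f) u =
      fderiv ℝ (fderiv ℝ f.1) u (EuclideanSpace.single a 1) (EuclideanSpace.single b 1) := by
    intro a b
    change fderiv ℝ (fun w => fderiv ℝ f.1 w (EuclideanSpace.single b 1)) u _ = _
    rw [fderiv_clm_apply hd (by fun_prop)]
    simp
  rw [key, key]
  exact ((smooth f).contDiffAt.isSymmSndFDerivAt
    (by simp; exact WithTop.coe_le_coe.2 le_top)).eq _ _

/-- Commutation of partial derivatives, oriented towards a normal form. -/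
@[simp] theorem D_one_zero (f : Smooth) : D 1 (D 0 f) = D 0 (D 1 f) := D_comm _ _ _

/-- The conformal factor of the stereographic coordinates: the round metric is
`lam² (du₀² + du₁²)`. -/
def lam : Smooth := ⟨fun u => 4 / (4 + u 0 ^ 2 + u 1 ^ 2), mem_iff.2
  (ContDiff.div contDiff_const (by fun_prop) fun u => by positivity)⟩

/-- The inverse of the conformal factor, `1 + |u|² / 4`. -/
def ilam : Smooth := C 1 + C (1 / 4) * (U 0 ^ 2 + U 1 ^ 2)

theorem lam_apply (u : E2) : lam u = 4 / (4 + u 0 ^ 2 + u 1 ^ 2) := rfl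

theorem lam_pos (u : E2) : 0 < lam u := by rw [lam_apply]; positivity

theorem ilam_apply (u : E2) : ilam u = 1 + (1 / 4) * (u 0 ^ 2 + u 1 ^ 2) := rfl

theorem lam_mul_ilam_apply (u : E2) : lam u * ilam u = 1 := by
  rw [lam_apply, ilam_apply]
  have : 4 + u 0 ^ 2 + u 1 ^ 2 ≠ 0 := by positivity
  field_simp
  ring

theorem lam_mul_ilam : lam * ilam = 1 := ext lam_mul_ilam_apply

@[simp] theorem D_ilam (i : Fin 2) : D i ilam = C (1 / 2) * U i := by
  ext u
  fin_cases i <;> simp [ilam] <;> ring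

@[simp] theorem D_lam (i : Fin 2) : D i lam = C (-1 / 2) * lam ^ 2 * U i := by
  have h := congrArg (D i) lam_mul_ilam
  rw [D_mul, D_one, D_ilam] at h
  ext u
  have h1 := congrFun (congrArg Subtype.val h) u
  have h2 := lam_mul_ilam_apply u
  simp at h1 ⊢
  linear_combination (lam u) * h1 - (D i lam u) * h2

@[simp] theorem lam_zero : lam 0 = 1 := by simp [lam_apply]

@[simp] theorem ilam_zero : ilam 0 = 1 := by simp [ilam_apply]

end Smooth

open Smooth

/-! ### Stereographic coordinates -/

/-- The orthonormal basis of the plane `p^⊥` used by the stereographic coordinates centred at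
`p`. -/
def axis (p : S2) (i : Fin 2) : E3 :=
  haveI := fact_finrank_E3
  (OrthonormalBasis.fromOrthogonalSpanSingleton (𝕜 := ℝ) 2 (ne_zero_of_mem_unit_sphere (-p)) i : E3)

theorem inner_axis (p : S2) (i j : Fin 2) : ⟪axis p i, axis p j⟫ = if i = j then 1 else 0 := by
  have := fact_finrank_E3
  exact orthonormal_iff_ite.1 (OrthonormalBasis.fromOrthogonalSpanSingleton (𝕜 := ℝ) 2
    (ne_zero_of_mem_unit_sphere (-p))).orthonormal i j

@[simp] theorem norm_axis (p : S2) (i : Fin 2) : ‖axis p i‖ = 1 := by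
  have h := inner_axis p i i
  rw [real_inner_self_eq_norm_sq, if_pos rfl] at h
  exact (pow_eq_one_iff_of_nonneg (norm_nonneg _) two_ne_zero).1 h

theorem inner_center_axis (p : S2) (i : Fin 2) : ⟪(p : E3), axis p i⟫ = 0 := by
  have := fact_finrank_E3
  have h := Submodule.mem_orthogonal_singleton_iff_inner_right.1
    (OrthonormalBasis.fromOrthogonalSpanSingleton (𝕜 := ℝ) 2
      (ne_zero_of_mem_unit_sphere (-p)) i).2
  simpa [axis] using h

theorem inner_axis_center (p : S2) (i : Fin 2) : ⟪axis p i, (p : E3)⟫ = 0 := by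
  rw [real_inner_comm, inner_center_axis]

theorem inner_coe_self (p : S2) : ⟪(p : E3), (p : E3)⟫ = 1 := by
  rw [real_inner_self_eq_norm_sq, norm_eq_of_mem_sphere]; norm_num

theorem ext_inner_axis (p : S2) {X Y : E3} (h : ∀ i, ⟪axis p i, X⟫ = ⟪axis p i, Y⟫)
    (hp : ⟪(p : E3), X⟫ = ⟪(p : E3), Y⟫) : X = Y := by
  have := fact_finrank_E3
  let b := OrthonormalBasis.fromOrthogonalSpanSingleton (𝕜 := ℝ) 2
    (ne_zero_of_mem_unit_sphere (-p))
  have hz : X - Y ∈ (ℝ ∙ ((-p : S2) : E3))ᗮ := by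
    rw [Submodule.mem_orthogonal_singleton_iff_inner_right]
    simp [inner_sub_right, hp]
  have : (⟨X - Y, hz⟩ : ((ℝ ∙ ((-p : S2) : E3))ᗮ : Submodule ℝ E3)) = 0 := by
    apply InnerProductSpace.ext_inner_left_basis b.toBasis
    intro i
    have := h i
    rw [OrthonormalBasis.coe_toBasis, inner_zero_right]
    change ⟪axis p i, X - Y⟫ = _
    simp [inner_sub_right, this]
  exact sub_eq_zero.1 (congrArg Subtype.val this)

theorem eq_sum_axis (p : S2) (X : E3) :
    X = ⟪axis p 0, X⟫ • axis p 0 + ⟪axis p 1, X⟫ • axis p 1 + ⟪(p : E3), X⟫ • (p : E3) := by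
  apply ext_inner_axis p
  · intro i
    fin_cases i <;> simp [inner_add_right, inner_smul_right, inner_axis, inner_axis_center]
  · simp [inner_add_right, inner_smul_right, inner_center_axis]

theorem inner_eq_axis (p : S2) (X Y : E3) :
    ⟪X, Y⟫ = ⟪axis p 0, X⟫ * ⟪axis p 0, Y⟫ + ⟪axis p 1, X⟫ * ⟪axis p 1, Y⟫
      + ⟪(p : E3), X⟫ * ⟪(p : E3), Y⟫ := by
  conv_lhs => rw [eq_sum_axis p X]
  simp [inner_add_left, inner_smul_left]

theorem coe_param (p : S2) (u : E2) :
    (param p u : E3) = (lam u * u 0) • axis p 0 + (lam u * u 1) • axis p 1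
      + (2 * lam u - 1) • (p : E3) := by
  have := fact_finrank_E3
  let b := OrthonormalBasis.fromOrthogonalSpanSingleton (𝕜 := ℝ) 2
    (ne_zero_of_mem_unit_sphere (-p))
  have h := stereographic'_symm_apply (-p) u
  have hn : ‖(b.repr.symm u : E3)‖ ^ 2 = u 0 ^ 2 + u 1 ^ 2 := by
    rw [← Submodule.coe_norm, LinearIsometryEquiv.norm_map, EuclideanSpace.norm_sq_eq]
    simp
  have hs : (b.repr.symm u : E3) = u 0 • axis p 0 + u 1 • axis p 1 := by
    rw [← b.sum_repr_symm, Fin.sum_univ_two]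
    rfl
  change (param p u : E3) = _ at h
  rw [h]
  dsimp only
  change (‖(b.repr.symm u : E3)‖ ^ 2 + 4)⁻¹ • (4 : ℝ) • (b.repr.symm u : E3) +
    (‖(b.repr.symm u : E3)‖ ^ 2 + 4)⁻¹ • (‖(b.repr.symm u : E3)‖ ^ 2 - 4) • _ = _
  rw [hn, hs, lam_apply]
  have h0 : 4 + u 0 ^ 2 + u 1 ^ 2 ≠ 0 := by positivity
  have h1 : u 0 ^ 2 + u 1 ^ 2 + 4 ≠ 0 := by positivity
  simp only [coe_neg_sphere]
  match_scalars <;> field_simp <;> ring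

theorem chart_self (p : S2) : chartAt E2 p p = 0 := by
  have := fact_finrank_E3
  change stereographic' 2 (-p) p = 0
  have h : stereographic (norm_eq_of_mem_sphere (-p)) p = 0 := stereographic_neg_apply p
  change (OrthonormalBasis.fromOrthogonalSpanSingleton (𝕜 := ℝ) 2
    (ne_zero_of_mem_unit_sphere (-p))).repr (stereographic (norm_eq_of_mem_sphere (-p)) p) = 0
  rw [h, map_zero]

theorem param_zero (p : S2) : param p 0 = p := by
  rw [param, ← chart_self p]
  exact (chartAt E2 p).left_inv (mem_chart_source E2 p)

/-- The coordinate vector fields of the stereographic coordinates centred at `p`, as vectors in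
Euclidean space. -/
def cvec (p : S2) (i : Fin 2) (u : E2) : E3 :=
  lam u • axis p i - (1 / 2 * lam u ^ 2 * u i) • (u 0 • axis p 0 + u 1 • axis p 1)
    - (lam u ^ 2 * u i) • (p : E3)

theorem fderiv_smul_const_single (f : Smooth) (c : E3) (i : Fin 2) (u : E2) :
    fderiv ℝ (fun w => f w • c) u (EuclideanSpace.single i 1) = D i f u • c := by
  rw [fderiv_fun_smul (diff f u) (by fun_prop)]
  simp [D_apply, pd]

theorem differentiable_smul_const (f : Smooth) (c : E3) :
    Differentiable ℝ (fun w => f w • c) := (diff f).smul_const c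

theorem coe_param_smooth (p : S2) :
    (fun u => (param p u : E3)) = fun u => (lam * U 0) u • axis p 0 + (lam * U 1) u • axis p 1
      + (C 2 * lam - 1) u • (p : E3) := by
  ext1 u
  rw [coe_param]
  rfl

theorem differentiable_coe_param (p : S2) : Differentiable ℝ (fun u => (param p u : E3)) := by
  rw [coe_param_smooth]
  exact ((differentiable_smul_const _ _).add (differentiable_smul_const _ _)).add
    (differentiable_smul_const _ _)

theorem fderiv_coe_param (p : S2) (i : Fin 2) (u : E2) :
    fderiv ℝ (fun w => (param p w : E3)) u (EuclideanSpace.single i 1) = cvec p i u := by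
  rw [coe_param_smooth, fderiv_fun_add
    (by exact (differentiable_smul_const _ _ u).fun_add (differentiable_smul_const _ _ u))
    (differentiable_smul_const _ _ u), fderiv_fun_add (differentiable_smul_const _ _ u)
    (differentiable_smul_const _ _ u)]
  simp only [_root_.add_apply, fderiv_smul_const_single, cvec]
  fin_cases i <;> simp <;> module

theorem inner_param_cvec (p : S2) (i : Fin 2) (u : E2) : ⟪(param p u : E3), cvec p i u⟫ = 0 := by
  have h := lam_mul_ilam_apply u
  rw [ilam_apply] at h
  rw [inner_eq_axis p, coe_param]
  fin_cases i <;> simp [cvec, inner_add_right, inner_sub_right, inner_smul_right, inner_axis,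
    inner_axis_center, inner_center_axis]
  · linear_combination (-2 * lam u ^ 2 * u 0) * h
  · linear_combination (-2 * lam u ^ 2 * u 1) * h

theorem inner_cvec (p : S2) (i j : Fin 2) (u : E2) :
    ⟪cvec p i u, cvec p j u⟫ = lam u ^ 2 * if i = j then 1 else 0 := by
  have h := lam_mul_ilam_apply u
  rw [ilam_apply] at h
  rw [inner_eq_axis p]
  fin_cases i <;> fin_cases j <;> simp [cvec, inner_add_right, inner_sub_right, inner_smul_right,
    inner_axis, inner_axis_center, inner_center_axis]
  · linear_combination (lam u ^ 3 * u 0 ^ 2) * h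
  · linear_combination (lam u ^ 3 * u 0 * u 1) * h
  · linear_combination (lam u ^ 3 * u 0 * u 1) * h
  · linear_combination (lam u ^ 3 * u 1 ^ 2) * h

theorem inner_coe_tan (x : S2) (X : Tan x) : ⟪(x : E3), (X : E3)⟫ = 0 :=
  Submodule.mem_orthogonal_singleton_iff_inner_right.1 X.2

theorem cvec_mem (p : S2) (i : Fin 2) (u : E2) :
    cvec p i u ∈ ((ℝ ∙ (param p u : E3))ᗮ : Submodule ℝ E3) :=
  Submodule.mem_orthogonal_singleton_iff_inner_right.2 (inner_param_cvec p i u)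

theorem coe_coordVec (p : S2) (i : Fin 2) (u : E2) : (coordVec p i u : E3) = cvec p i u := by
  rw [coordVec, fderiv_coe_param, proj]
  exact congrArg Subtype.val
    (Submodule.orthogonalProjectionOnto_mem_subspace_eq_self ⟨_, cvec_mem p i u⟩)

/-- The coframe `θ⁰, θ¹` dual to the coordinate vector fields, evaluated on the tangential part of
the constant vector `X`, as a function of the coordinates. -/
def coframe (p : S2) (l : Fin 2) (X : E3) : Smooth :=
  ilam * C ⟪axis p l, X⟫ - C (1 / 2) * U l * (U 0 * C ⟪axis p 0, X⟫ + U 1 * C ⟪axis p 1, X⟫)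
    - U l * C ⟪(p : E3), X⟫

theorem coframe_apply (p : S2) (l : Fin 2) (X : E3) (u : E2) :
    coframe p l X u = ilam u * ⟪axis p l, X⟫
      - 1 / 2 * u l * (u 0 * ⟪axis p 0, X⟫ + u 1 * ⟪axis p 1, X⟫) - u l * ⟪(p : E3), X⟫ := rfl

theorem coframe_add (p : S2) (l : Fin 2) (X Y : E3) (u : E2) :
    coframe p l (X + Y) u = coframe p l X u + coframe p l Y u := by
  simp only [coframe_apply, inner_add_right]; ring

theorem coframe_smul (p : S2) (l : Fin 2) (c : ℝ) (X : E3) (u : E2) :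
    coframe p l (c • X) u = c * coframe p l X u := by
  simp only [coframe_apply, inner_smul_right]; ring

theorem coframe_param (p : S2) (l : Fin 2) (u : E2) : coframe p l (param p u) u = 0 := by
  have h := lam_mul_ilam_apply u
  rw [ilam_apply] at h
  rw [coframe_apply, coe_param, ilam_apply]
  fin_cases l <;> simp [inner_add_right, inner_smul_right, inner_axis, inner_axis_center,
    inner_center_axis]
  · linear_combination (-u 0) * h
  · linear_combination (-u 1) * h

theorem sum_coord_mul_axis (p : S2) (u : E2) {X : E3} (hX : ⟪(param p u : E3), X⟫ = 0) :
    u 0 * ⟪axis p 0, X⟫ + u 1 * ⟪axis p 1, X⟫ = (ilam u - 2) * ⟪(p : E3), X⟫ := by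
  have h := lam_mul_ilam_apply u
  rw [coe_param, inner_add_left, inner_add_left, real_inner_smul_left, real_inner_smul_left,
    real_inner_smul_left] at hX
  linear_combination ilam u * hX
    - (u 0 * ⟪axis p 0, X⟫ + u 1 * ⟪axis p 1, X⟫ + 2 * ⟪(p : E3), X⟫) * h

theorem coframe_of_tangent (p : S2) (u : E2) {X : E3} (hX : ⟪(param p u : E3), X⟫ = 0)
    (i : Fin 2) :
    coframe p i X u = ilam u * (⟪axis p i, X⟫ - 1 / 2 * u i * ⟪(p : E3), X⟫) := by
  rw [coframe_apply]
  linear_combination (-1 / 2 * u i) * sum_coord_mul_axis p u hX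

theorem sum_coord_mul_coframe (p : S2) (u : E2) {X : E3} (hX : ⟪(param p u : E3), X⟫ = 0) :
    u 0 * coframe p 0 X u + u 1 * coframe p 1 X u = - ilam u ^ 2 * ⟪(p : E3), X⟫ := by
  rw [coframe_of_tangent p u hX, coframe_of_tangent p u hX]
  linear_combination (ilam u) * sum_coord_mul_axis p u hX
    + (2 * ilam u * ⟪(p : E3), X⟫) * ilam_apply u

theorem eq_sum_cvec (p : S2) (u : E2) {X : E3} (hX : ⟪(param p u : E3), X⟫ = 0) :
    X = coframe p 0 X u • cvec p 0 u + coframe p 1 X u • cvec p 1 u := by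
  have h := lam_mul_ilam_apply u
  have h3 := coframe_of_tangent p u hX
  have h4 := sum_coord_mul_coframe p u hX
  have h5 : lam u ^ 2 * ilam u ^ 2 = 1 := by rw [← mul_pow, h, one_pow]
  apply ext_inner_axis p
  · intro i
    fin_cases i <;> simp [cvec, inner_add_right, inner_sub_right, inner_smul_right,
      inner_axis, inner_axis_center]
    · linear_combination (1 / 2 * lam u ^ 2 * u 0) * h4 - lam u * h3 0
        - (⟪axis p 0, X⟫ - 1 / 2 * u 0 * ⟪(p : E3), X⟫) * h - (1 / 2 * u 0 * ⟪(p : E3), X⟫) * h5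
    · linear_combination (1 / 2 * lam u ^ 2 * u 1) * h4 - lam u * h3 1
        - (⟪axis p 1, X⟫ - 1 / 2 * u 1 * ⟪(p : E3), X⟫) * h - (1 / 2 * u 1 * ⟪(p : E3), X⟫) * h5
  · simp [cvec, inner_add_right, inner_sub_right, inner_smul_right,
      inner_center_axis]
    linear_combination (lam u ^ 2) * h4 - ⟪(p : E3), X⟫ * h5

theorem coe_tan_eq_sum (p : S2) (u : E2) (X : Tan (param p u)) :
    (X : E3) = coframe p 0 X u • cvec p 0 u + coframe p 1 X u • cvec p 1 u :=
  eq_sum_cvec p u (inner_coe_tan _ X)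

/-- The round metric in stereographic coordinates. -/
theorem inner_tan (p : S2) (u : E2) (X Y : Tan (param p u)) :
    ⟪X, Y⟫ = lam u ^ 2 *
      (coframe p 0 X u * coframe p 0 Y u + coframe p 1 X u * coframe p 1 Y u) := by
  rw [Submodule.coe_inner]
  conv_lhs => rw [coe_tan_eq_sum p u X, coe_tan_eq_sum p u Y]
  simp only [inner_add_left, inner_add_right, inner_smul_left, inner_smul_right, inner_cvec]
  simp
  ring

theorem coframe_proj (p : S2) (l : Fin 2) (X : E3) (u : E2) :
    coframe p l (proj (param p u) X : E3) u = coframe p l X u := by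
  have hx : X = (proj (param p u) X : E3) + ⟪(param p u : E3), X⟫ • (param p u : E3) := by
    have h := (ℝ ∙ (param p u : E3)).starProjection_add_starProjection_orthogonal X
    rw [Submodule.starProjection_unit_singleton ℝ (norm_eq_of_mem_sphere _)] at h
    rw [add_comm]
    exact h.symm
  conv_rhs => rw [hx]
  rw [coframe_add, coframe_smul, coframe_param, mul_zero, add_zero]

theorem radial_coe (x : S2) : radial (x : E3) = x := by
  have h : (x : E3) ≠ 0 := ne_zero_of_mem_unit_sphere x
  rw [radial, dif_neg h]
  ext1
  simp

theorem coe_radial {y : E3} (hy : y ≠ 0) : (radial y : E3) = ‖y‖⁻¹ • y := by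
  rw [radial, dif_neg hy]

theorem contDiffAt_coe_radial (x : S2) :
    ContDiffAt ℝ ∞ (fun y => (radial y : E3)) (x : E3) := by
  have h : (x : E3) ≠ 0 := ne_zero_of_mem_unit_sphere x
  have h1 : ContDiffAt ℝ ∞ (fun y : E3 => ‖y‖⁻¹ • y) x :=
    ((contDiffAt_norm ℝ h).inv (norm_ne_zero_iff.2 h)).smul contDiffAt_id
  refine h1.congr_of_eventuallyEq ?_
  filter_upwards [isOpen_ne.mem_nhds h] with y hy using coe_radial hy

theorem param_ne_neg (p : S2) (u : E2) : param p u ≠ -p := by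
  have := fact_finrank_E3
  have h : param p u ∈ (stereographic' 2 (-p)).source :=
    (stereographic' 2 (-p)).map_target (by simp)
  simpa using h

theorem param_chart {p x : S2} (hx : x ≠ -p) : param p (chartAt E2 p x) = x := by
  have := fact_finrank_E3
  exact (stereographic' 2 (-p)).left_inv (by simpa using hx)

/-- The stereographic coordinates of the radial projection are differentiable. -/
theorem differentiableAt_chart_radial (p : S2) (u : E2) :
    DifferentiableAt ℝ (fun y => chartAt E2 p (radial y)) (param p u : E3) := by
  have := fact_finrank_E3
  have hne : innerSL ℝ ((-p : S2) : E3) (param p u : E3) ≠ 1 := by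
    intro h
    exact param_ne_neg p u ((sphere_ext_iff _ _).2 h).symm
  have h1 : DifferentiableAt ℝ (stereoToFun ((-p : S2) : E3)) (param p u : E3) := by
    refine ((contDiffOn_stereoToFun (n := 1)).contDiffAt ?_).differentiableAt (by simp)
    exact (isOpen_ne.preimage (innerSL ℝ ((-p : S2) : E3)).continuous).mem_nhds hne
  have h2 := (contDiffAt_coe_radial (param p u)).differentiableAt (by simp)
  have h3 : DifferentiableAt ℝ (fun y => stereoToFun ((-p : S2) : E3) (radial y : E3))
      (param p u : E3) := by
    refine DifferentiableAt.comp (g := stereoToFun ((-p : S2) : E3))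
      (f := fun y => (radial y : E3)) (param p u : E3) ?_ h2
    rw [radial_coe]
    exact h1
  let b := OrthonormalBasis.fromOrthogonalSpanSingleton (𝕜 := ℝ) 2
    (ne_zero_of_mem_unit_sphere (-p))
  exact DifferentiableAt.comp (f := fun y => stereoToFun ((-p : S2) : E3) (radial y : E3))
    (param p u : E3) b.repr.toContinuousLinearEquiv.differentiableAt h3

/-! ### The covariant derivative in coordinates -/

/-- The derivative of a function on the sphere along a tangent vector, in coordinates. -/
theorem fderiv_radial (p : S2) (u : E2) (F : S2 → ℝ) (G : Smooth)
    (hG : ∀ w, F (param p w) = G w) (X : Tan (param p u)) :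
    fderiv ℝ (fun y : E3 => F (radial y)) (param p u) (X : E3) =
      coframe p 0 X u * D 0 G u + coframe p 1 X u * D 1 G u := by
  have hne : ∀ᶠ y in nhds (param p u : E3), radial y ≠ -p := by
    have hc : ContinuousAt (fun y => (radial y : E3)) (param p u : E3) :=
      (contDiffAt_coe_radial (param p u)).continuousAt
    have : (radial (param p u : E3) : E3) ≠ ((-p : S2) : E3) := by
      rw [radial_coe]
      exact fun h => param_ne_neg p u (Subtype.ext h)
    filter_upwards [hc.eventually_ne this] with y hy h
    exact hy (congrArg Subtype.val h)
  have hev : (fun y : E3 => F (radial y)) =ᶠ[nhds (param p u : E3)]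
      fun y => G (chartAt E2 p (radial y)) := by
    filter_upwards [hne] with y hy
    rw [← hG, param_chart hy]
  have hd : DifferentiableAt ℝ (fun y : E3 => F (radial y)) (param p u : E3) := by
    refine DifferentiableAt.congr_of_eventuallyEq ?_ hev
    exact DifferentiableAt.comp (g := G.1) (param p u : E3) (diff G _)
      (differentiableAt_chart_radial p u)
  have key : ∀ i, fderiv ℝ (fun y : E3 => F (radial y)) (param p u) (cvec p i u) = D i G u := by
    intro i
    have h := fderiv_comp u (g := fun y : E3 => F (radial y)) (f := fun w => (param p w : E3)) hd
      (differentiable_coe_param p u)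
    have h' : (fun y : E3 => F (radial y)) ∘ (fun w => (param p w : E3)) = G.1 := by
      ext w
      simp [radial_coe, hG]
    rw [h'] at h
    rw [D_apply, pd, h, ContinuousLinearMap.comp_apply, fderiv_coe_param]
  conv_lhs => rw [coe_tan_eq_sum p u X]
  rw [map_add, map_smul, map_smul, key, key, smul_eq_mul, smul_eq_mul]

/-- The covariant derivative of a tensor field in coordinates. The hypothesis concerns the function
whose derivative defines it: the arguments are extended by projecting constant vectors. -/
theorem nabla_param {k : ℕ} (T : TensorField k) (p : S2) (u : E2)
    (X : Fin (k + 1) → Tan (param p u)) (G : Smooth)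
    (hG : ∀ w, T (param p w) (fun i => proj (param p w) (X i.succ : E3)) = G w) :
    nabla T (param p u) X = coframe p 0 (X 0) u * D 0 G u + coframe p 1 (X 0) u * D 1 G u :=
  fderiv_radial p u (fun z => T z (fun i => proj z (X i.succ : E3))) G hG (X 0)

/-- The logarithmic derivatives `∂ᵢ log lam` of the conformal factor. -/
def phi (i : Fin 2) : Smooth := C (-1 / 2) * lam * U i

theorem phi_apply (i : Fin 2) (u : E2) : phi i u = -1 / 2 * lam u * u i := rfl

/-- The Christoffel symbols `Γ^l_{ij}` of the round metric. -/
def chris (l i j : Fin 2) : Smooth :=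
  (if l = i then phi j else 0) + (if l = j then phi i else 0) - (if i = j then phi l else 0)

@[simp] theorem chris_zero (l i j : Fin 2) : chris l i j 0 = 0 := by
  fin_cases l <;> fin_cases i <;> fin_cases j <;> simp [chris, phi]

/-- The derivatives of the coframe at a point where the constant vector `X` is tangent. Projecting
`X` to the nearby tangent planes does not change the value of the coframe (`coframe_proj`), so these
are the terms that the Christoffel symbols contribute to `nabla`. -/
theorem D_coframe (p : S2) (l i : Fin 2) (u : E2) (X : Tan (param p u)) :
    D i (coframe p l X) u =
      -(chris l i 0 u * coframe p 0 X u + chris l i 1 u * coframe p 1 X u) := by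
  have h := lam_mul_ilam_apply u
  have hX := inner_coe_tan _ X
  have h2 := sum_coord_mul_axis p u hX
  have h3 := coframe_of_tangent p u hX
  have h4 := sum_coord_mul_coframe p u hX
  have h5 : lam u * ilam u ^ 2 = ilam u := by rw [pow_two, ← mul_assoc, h, one_mul]
  have hD : D i (coframe p l X) u = 1 / 2 * u i * ⟪axis p l, (X : E3)⟫
      - 1 / 2 * u l * ⟪axis p i, (X : E3)⟫ - (if i = l then 1 else 0) *
        (1 / 2 * (u 0 * ⟪axis p 0, (X : E3)⟫ + u 1 * ⟪axis p 1, (X : E3)⟫)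
          + ⟪(p : E3), (X : E3)⟫) := by
    fin_cases l <;> fin_cases i <;> simp [coframe] <;> ring
  rw [hD]
  fin_cases l <;> fin_cases i <;> simp [chris, phi]
  · linear_combination (-1 / 2) * h2 - 1 / 2 * lam u * h4 + 1 / 2 * ⟪(p : E3), (X : E3)⟫ * h5
  · linear_combination 1 / 2 * lam u * (u 0 * h3 1 - u 1 * h3 0)
      + 1 / 2 * (u 0 * ⟪axis p 1, (X : E3)⟫ - u 1 * ⟪axis p 0, (X : E3)⟫) * h
  · linear_combination 1 / 2 * lam u * (u 1 * h3 0 - u 0 * h3 1)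
      + 1 / 2 * (u 1 * ⟪axis p 0, (X : E3)⟫ - u 0 * ⟪axis p 1, (X : E3)⟫) * h
  · linear_combination (-1 / 2) * h2 - 1 / 2 * lam u * h4 + 1 / 2 * ⟪(p : E3), (X : E3)⟫ * h5

/-! ### Components of tensor fields and of their covariant derivatives -/

/-- The `0`-tensor `T` is the smooth function `t` in the stereographic coordinates centred at
`p`. -/
def Comp0 (p : S2) (T : TensorField 0) (t : Smooth) : Prop :=
  ∀ u X, T (param p u) X = t u

/-- The `1`-tensor `T` has the smooth components `t` in the stereographic coordinates centred at
`p`. -/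
def Comp1 (p : S2) (T : TensorField 1) (t : Fin 2 → Smooth) : Prop :=
  ∀ u X, T (param p u) X = ∑ i, t i u * coframe p i (X 0) u

/-- The `2`-tensor `T` has the smooth components `t` in the stereographic coordinates centred at
`p`. -/
def Comp2 (p : S2) (T : TensorField 2) (t : Fin 2 → Fin 2 → Smooth) : Prop :=
  ∀ u X, T (param p u) X = ∑ j, (∑ i, t i j u * coframe p i (X 0) u) * coframe p j (X 1) u

/-- The `3`-tensor `T` has the smooth components `t` in the stereographic coordinates centred at
`p`. -/
def Comp3 (p : S2) (T : TensorField 3) (t : Fin 2 → Fin 2 → Fin 2 → Smooth) : Prop :=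
  ∀ u X, T (param p u) X = ∑ k, (∑ j, (∑ i, t i j k u * coframe p i (X 0) u)
    * coframe p j (X 1) u) * coframe p k (X 2) u

/-- The `4`-tensor `T` has the smooth components `t` in the stereographic coordinates centred at
`p`. -/
def Comp4 (p : S2) (T : TensorField 4) (t : Fin 2 → Fin 2 → Fin 2 → Fin 2 → Smooth) : Prop :=
  ∀ u X, T (param p u) X = ∑ l, (∑ k, (∑ j, (∑ i, t i j k l u * coframe p i (X 0) u)
    * coframe p j (X 1) u) * coframe p k (X 2) u) * coframe p l (X 3) u

variable {p : S2}

theorem Comp0.nabla {T : TensorField 0} {t : Smooth} (h : Comp0 p T t) :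
    Comp1 p (nabla T) fun i => D i t := by
  intro u X
  rw [nabla_param T p u X t (fun w => h w _), Fin.sum_univ_two]
  ring

theorem Comp1.nabla {T : TensorField 1} {t : Fin 2 → Smooth} (h : Comp1 p T t) :
    Comp2 p (nabla T) fun i j => D i (t j) - (chris 0 i j * t 0 + chris 1 i j * t 1) := by
  intro u X
  rw [nabla_param T p u X (t 0 * coframe p 0 (X 1) + t 1 * coframe p 1 (X 1))]
  · simp [D_coframe]
    ring
  · intro w
    rw [h]
    simp [coframe_proj]

theorem Comp2.nabla {T : TensorField 2} {t : Fin 2 → Fin 2 → Smooth} (h : Comp2 p T t) :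
    Comp3 p (nabla T) fun i j k => D i (t j k) - (chris 0 i j * t 0 k + chris 1 i j * t 1 k)
      - (chris 0 i k * t j 0 + chris 1 i k * t j 1) := by
  intro u X
  rw [nabla_param T p u X
    ((t 0 0 * coframe p 0 (X 1) + t 1 0 * coframe p 1 (X 1)) * coframe p 0 (X 2)
      + (t 0 1 * coframe p 0 (X 1) + t 1 1 * coframe p 1 (X 1)) * coframe p 1 (X 2))]
  · simp [D_coframe]
    ring
  · intro w
    rw [h]
    simp [coframe_proj]

theorem Comp3.nabla {T : TensorField 3} {t : Fin 2 → Fin 2 → Fin 2 → Smooth} (h : Comp3 p T t) :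
    Comp4 p (nabla T) fun i j k l => D i (t j k l)
      - (chris 0 i j * t 0 k l + chris 1 i j * t 1 k l)
      - (chris 0 i k * t j 0 l + chris 1 i k * t j 1 l)
      - (chris 0 i l * t j k 0 + chris 1 i l * t j k 1) := by
  intro u X
  rw [nabla_param T p u X
    (((t 0 0 0 * coframe p 0 (X 1) + t 1 0 0 * coframe p 1 (X 1)) * coframe p 0 (X 2)
      + (t 0 1 0 * coframe p 0 (X 1) + t 1 1 0 * coframe p 1 (X 1)) * coframe p 1 (X 2))
        * coframe p 0 (X 3)
      + ((t 0 0 1 * coframe p 0 (X 1) + t 1 0 1 * coframe p 1 (X 1)) * coframe p 0 (X 2)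
      + (t 0 1 1 * coframe p 0 (X 1) + t 1 1 1 * coframe p 1 (X 1)) * coframe p 1 (X 2))
        * coframe p 1 (X 3))]
  · simp [D_coframe]
    ring
  · intro w
    rw [h]
    simp [coframe_proj, show Fin.succ (2 : Fin 3) = 3 from rfl]

theorem coframe_cvec (p : S2) (a b : Fin 2) (u : E2) :
    coframe p a (cvec p b u) u = if a = b then 1 else 0 := by
  have h := lam_mul_ilam_apply u
  rw [coframe_of_tangent p u (inner_param_cvec p b u)]
  fin_cases a <;> fin_cases b <;> simp [cvec, inner_add_right, inner_sub_right, inner_smul_right,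
    inner_axis, inner_axis_center, inner_center_axis]
  · linear_combination h
  · right; ring
  · right; ring
  · linear_combination h

/-! ### Traces, norms and trace-free parts in components -/

/-- The coframe, evaluated on an orthonormal frame, is `lam⁻¹` times an orthogonal matrix. -/
theorem sum_coframe_frame (p : S2) (u : E2) (l m : Fin 2) :
    ∑ i, coframe p l (frame (param p u) i) u * coframe p m (frame (param p u) i) u =
      ilam u ^ 2 * if l = m then 1 else 0 := by
  have hin : ∀ (l : Fin 2) (X : Tan (param p u)),
      ⟪coordVec p l u, X⟫ = lam u ^ 2 * coframe p l X u := by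
    intro l X
    rw [inner_tan, coe_coordVec, coframe_cvec, coframe_cvec]
    fin_cases l <;> simp
  have h := (frame (param p u)).sum_inner_mul_inner (coordVec p l u) (coordVec p m u)
  have h2 : ∀ i, ⟪frame (param p u) i, coordVec p m u⟫ =
      lam u ^ 2 * coframe p m (frame (param p u) i) u := fun i => by
    rw [real_inner_comm, hin]
  simp only [hin, h2, coe_coordVec, coframe_cvec] at h
  have h4 := lam_mul_ilam_apply u
  have h5 : (lam u * ilam u) ^ 2 = 1 := by rw [h4, one_pow]
  have h6 : (lam u * ilam u) ^ 4 = 1 := by rw [h4, one_pow]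
  rw [Fin.sum_univ_two] at h ⊢
  linear_combination ilam u ^ 4 * h
    - (coframe p l (frame (param p u) 0) u * coframe p m (frame (param p u) 0) u
      + coframe p l (frame (param p u) 1) u * coframe p m (frame (param p u) 1) u) * h6
    + ilam u ^ 2 * (if l = m then 1 else 0) * h5

theorem sum_sq_coframe_frame (p : S2) (u : E2) (a : Fin 2 → ℝ) :
    ∑ i, (∑ l, a l * coframe p l (frame (param p u) i) u) ^ 2 = ilam u ^ 2 * ∑ l, a l ^ 2 := by
  have h := sum_coframe_frame p u
  have h0 := h 0 0
  have h1 := h 0 1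
  have h2 := h 1 1
  simp only [Fin.sum_univ_two, Fin.isValue] at *
  simp at h0 h1 h2
  linear_combination a 0 ^ 2 * h0 + 2 * a 0 * a 1 * h1 + a 1 ^ 2 * h2

theorem Comp2.tr12 {T : TensorField 2} {t : Fin 2 → Fin 2 → Smooth} (h : Comp2 p T t) :
    Comp0 p (tr12 T) (ilam ^ 2 * (t 0 0 + t 1 1)) := by
  intro u X
  have h0 := sum_coframe_frame p u 0 0
  have h1 := sum_coframe_frame p u 0 1
  have h2 := sum_coframe_frame p u 1 1
  have e1 : ∀ Y : Tan (param p u),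
    (Fin.cons Y (Fin.cons Y X) : Fin 2 → Tan (param p u)) 1 = Y := fun _ => rfl
  rw [SphereFlow.tr12, Fin.sum_univ_two, h, h]
  simp [Fin.sum_univ_two, e1] at *
  linear_combination t 0 0 u * h0 + (t 0 1 u + t 1 0 u) * h1 + t 1 1 u * h2

theorem Comp4.tr12 {T : TensorField 4} {t : Fin 2 → Fin 2 → Fin 2 → Fin 2 → Smooth}
    (h : Comp4 p T t) :
    Comp2 p (tr12 T) fun k l => ilam ^ 2 * (t 0 0 k l + t 1 1 k l) := by
  intro u X
  have h0 := sum_coframe_frame p u 0 0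
  have h1 := sum_coframe_frame p u 0 1
  have h2 := sum_coframe_frame p u 1 1
  have e1 : ∀ Y : Tan (param p u),
    (Fin.cons Y (Fin.cons Y X) : Fin 4 → Tan (param p u)) 1 = Y := fun _ => rfl
  have e2 : ∀ Y : Tan (param p u),
    (Fin.cons Y (Fin.cons Y X) : Fin 4 → Tan (param p u)) 2 = X 0 := fun _ => rfl
  have e3 : ∀ Y : Tan (param p u),
    (Fin.cons Y (Fin.cons Y X) : Fin 4 → Tan (param p u)) 3 = X 1 := fun _ => rfl
  let r : (Fin 2 → Fin 2 → Smooth) → ℝ := fun s =>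
    (s 0 0 u * coframe p 0 (X 0) u + s 1 0 u * coframe p 1 (X 0) u) * coframe p 0 (X 1) u
      + (s 0 1 u * coframe p 0 (X 0) u + s 1 1 u * coframe p 1 (X 0) u) * coframe p 1 (X 1) u
  rw [SphereFlow.tr12, Fin.sum_univ_two, h, h]
  simp only [Fin.cons_zero, e1, e2, e3]
  simp at h0 h1 h2
  simp [Fin.sum_univ_two]
  linear_combination r (t 0 0) * h0 + (r (t 0 1) + r (t 1 0)) * h1 + r (t 1 1) * h2

theorem Comp3.tr23 {T : TensorField 3} {t : Fin 2 → Fin 2 → Fin 2 → Smooth} (h : Comp3 p T t) :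
    Comp1 p (tr23 T) fun i => ilam ^ 2 * (t i 0 0 + t i 1 1) := by
  intro u X
  have h0 := sum_coframe_frame p u 0 0
  have h1 := sum_coframe_frame p u 0 1
  have h2 := sum_coframe_frame p u 1 1
  let r : (Fin 2 → Smooth) → ℝ := fun s =>
    s 0 u * coframe p 0 (X 0) u + s 1 u * coframe p 1 (X 0) u
  rw [SphereFlow.tr23, Fin.sum_univ_two, h, h]
  simp [Fin.sum_univ_two] at *
  linear_combination r (fun i => t i 0 0) * h0 + (r (fun i => t i 0 1) + r (fun i => t i 1 0)) * h1
    + r (fun i => t i 1 1) * h2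

theorem sum_fin_succ {k : ℕ} (F : (Fin (k + 1) → Fin 2) → ℝ) :
    ∑ J, F J = ∑ i, ∑ J : Fin k → Fin 2, F (Fin.cons i J) := by
  rw [← (Fin.consEquiv fun _ => Fin 2).sum_comp, Fintype.sum_prod_type]
  rfl

theorem Comp1.normSq {T : TensorField 1} {t : Fin 2 → Smooth} (h : Comp1 p T t) (u : E2) :
    normSq T (param p u) = ilam u ^ 2 * ∑ i, t i u ^ 2 := by
  rw [SphereFlow.normSq, sum_fin_succ]
  simp only [h u, Fintype.sum_unique]
  exact sum_sq_coframe_frame p u (fun i => t i u)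

theorem sum_sq_coframe_frame₂ (p : S2) (u : E2) (a : Fin 2 → Fin 2 → ℝ) :
    ∑ i, ∑ j, (∑ m, (∑ l, a l m * coframe p l (frame (param p u) i) u)
      * coframe p m (frame (param p u) j) u) ^ 2 = ilam u ^ 4 * ∑ m, ∑ l, a l m ^ 2 := by
  simp_rw [sum_sq_coframe_frame, ← Finset.mul_sum]
  rw [Finset.sum_comm]
  simp_rw [sum_sq_coframe_frame, ← Finset.mul_sum]
  ring

theorem sum_sq_coframe_frame₃ (p : S2) (u : E2) (a : Fin 2 → Fin 2 → Fin 2 → ℝ) :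
    ∑ i, ∑ j, ∑ k, (∑ n, (∑ m, (∑ l, a l m n * coframe p l (frame (param p u) i) u)
      * coframe p m (frame (param p u) j) u) * coframe p n (frame (param p u) k) u) ^ 2
      = ilam u ^ 6 * ∑ n, ∑ m, ∑ l, a l m n ^ 2 := by
  have rot : ∀ F : Fin 2 → Fin 2 → Fin 2 → ℝ,
      ∑ i, ∑ j, ∑ n, F i j n = ∑ n, ∑ i, ∑ j, F i j n := by
    intro F
    simp only [Fin.sum_univ_two]
    ring
  simp_rw [sum_sq_coframe_frame, ← Finset.mul_sum]
  rw [rot]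
  simp_rw [sum_sq_coframe_frame₂, ← Finset.mul_sum]
  ring

theorem sum_sq_coframe_frame₄ (p : S2) (u : E2) (a : Fin 2 → Fin 2 → Fin 2 → Fin 2 → ℝ) :
    ∑ i, ∑ j, ∑ k, ∑ q, (∑ r, (∑ n, (∑ m, (∑ l, a l m n r
      * coframe p l (frame (param p u) i) u) * coframe p m (frame (param p u) j) u)
      * coframe p n (frame (param p u) k) u) * coframe p r (frame (param p u) q) u) ^ 2
      = ilam u ^ 8 * ∑ r, ∑ n, ∑ m, ∑ l, a l m n r ^ 2 := by
  have rot : ∀ F : Fin 2 → Fin 2 → Fin 2 → Fin 2 → ℝ,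
      ∑ i, ∑ j, ∑ k, ∑ n, F i j k n = ∑ n, ∑ i, ∑ j, ∑ k, F i j k n := by
    intro F
    simp only [Fin.sum_univ_two]
    ring
  simp_rw [sum_sq_coframe_frame, ← Finset.mul_sum]
  rw [rot]
  simp_rw [sum_sq_coframe_frame₃, ← Finset.mul_sum]
  ring

theorem Comp2.normSq {T : TensorField 2} {t : Fin 2 → Fin 2 → Smooth} (h : Comp2 p T t) (u : E2) :
    normSq T (param p u) = ilam u ^ 4 * ∑ j, ∑ i, t i j u ^ 2 := by
  simp only [SphereFlow.normSq, sum_fin_succ, h u, Fintype.sum_unique]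
  exact sum_sq_coframe_frame₂ p u (fun i j => t i j u)

theorem Comp3.normSq {T : TensorField 3} {t : Fin 2 → Fin 2 → Fin 2 → Smooth}
    (h : Comp3 p T t) (u : E2) :
    normSq T (param p u) = ilam u ^ 6 * ∑ k, ∑ j, ∑ i, t i j k u ^ 2 := by
  simp only [SphereFlow.normSq, sum_fin_succ, h u, Fintype.sum_unique]
  exact sum_sq_coframe_frame₃ p u (fun i j k => t i j k u)

theorem Comp4.normSq {T : TensorField 4} {t : Fin 2 → Fin 2 → Fin 2 → Fin 2 → Smooth}
    (h : Comp4 p T t) (u : E2) :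
    normSq T (param p u) = ilam u ^ 8 * ∑ l, ∑ k, ∑ j, ∑ i, t i j k l u ^ 2 := by
  simp only [SphereFlow.normSq, sum_fin_succ, h u, Fintype.sum_unique]
  exact sum_sq_coframe_frame₄ p u (fun i j k l => t i j k l u)

theorem Comp3.symm3 {T : TensorField 3} {t : Fin 2 → Fin 2 → Fin 2 → Smooth} (h : Comp3 p T t) :
    Comp3 p (symm3 T) fun i j k => C (1 / 3) * (t i j k + t j k i + t k i j) := by
  intro u X
  rw [SphereFlow.symm3, h, h, h]
  simp
  ring

@[simp] theorem Smooth.ite_apply (c : Prop) [Decidable c] (u : E2) :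
    (if c then (1 : Smooth) else 0) u = if c then 1 else 0 := by
  split_ifs <;> rfl

theorem Comp3.TF3 {T : TensorField 3} {t : Fin 2 → Fin 2 → Fin 2 → Smooth} (h : Comp3 p T t) :
    Comp3 p (TF3 T) fun i j k => t i j k - C (1 / 4) *
      ((t i 0 0 + t i 1 1) * (if j = k then 1 else 0)
        + (t j 0 0 + t j 1 1) * (if k = i then 1 else 0)
        + (t k 0 0 + t k 1 1) * (if i = j then 1 else 0)) := by
  intro u X
  have h4 : (lam u * ilam u) ^ 2 = 1 := by rw [lam_mul_ilam_apply u, one_pow]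
  have hz := fun Y => h.tr23 u ![Y]
  -- The identity is checked for real numbers in place of the values of the coframe.
  have key : ∀ (t : Fin 2 → Fin 2 → Fin 2 → ℝ) (x y z : Fin 2 → ℝ) (a b : ℝ), (a * b) ^ 2 = 1 →
      let Z : (Fin 2 → ℝ) → ℝ := fun x => 1 / 4 * ∑ i, b ^ 2 * (t i 0 0 + t i 1 1) * x i
      let g : (Fin 2 → ℝ) → (Fin 2 → ℝ) → ℝ := fun x y => a ^ 2 * (x 0 * y 0 + x 1 * y 1)
      ∑ k, (∑ j, (∑ i, t i j k * x i) * y j) * z k - (Z x * g y z + Z y * g z x + Z z * g x y)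
      = ∑ k, (∑ j, (∑ i, (t i j k - 1 / 4 *
      ((t i 0 0 + t i 1 1) * (if j = k then 1 else 0)
        + (t j 0 0 + t j 1 1) * (if k = i then 1 else 0)
        + (t k 0 0 + t k 1 1) * (if i = j then 1 else 0))) * x i) * y j) * z k := by
    intro t x y z a b hab Z g
    simp only [Z, g]
    simp
    linear_combination (-1 / 4 * (
      ((t 0 0 0 + t 0 1 1) * x 0 + (t 1 0 0 + t 1 1 1) * x 1) * (y 0 * z 0 + y 1 * z 1)
      + ((t 0 0 0 + t 0 1 1) * y 0 + (t 1 0 0 + t 1 1 1) * y 1) * (z 0 * x 0 + z 1 * x 1)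
      + ((t 0 0 0 + t 0 1 1) * z 0 + (t 1 0 0 + t 1 1 1) * z 1) * (x 0 * y 0 + x 1 * y 1))) * hab
  simp only [SphereFlow.TF3, hz, h u X, inner_tan]
  have := key (fun i j k => t i j k u) (fun i => coframe p i (X 0) u)
    (fun i => coframe p i (X 1) u) (fun i => coframe p i (X 2) u) _ _ h4
  simp only [sub_apply, add_apply, mul_apply, C_apply, Smooth.ite_apply]
  exact this

theorem Comp2.TF2 {T : TensorField 2} {t : Fin 2 → Fin 2 → Smooth} (h : Comp2 p T t) :
    Comp2 p (TF2 T) fun i j => t i j - C (1 / 2) * (t 0 0 + t 1 1) * (if i = j then 1 else 0) := by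
  intro u X
  have h4 : (lam u * ilam u) ^ 2 = 1 := by rw [lam_mul_ilam_apply u, one_pow]
  simp only [SphereFlow.TF2, h.tr12 u ![], h u X, inner_tan]
  simp
  linear_combination (-1 / 2 * (t 0 0 u + t 1 1 u) * (coframe p 0 (X 0) u * coframe p 0 (X 1) u
    + coframe p 1 (X 0) u * coframe p 1 (X 1) u)) * h4

theorem Comp1.tmul {w : TensorField 1} {T : TensorField 3} {a : Fin 2 → Smooth}
    {t : Fin 2 → Fin 2 → Fin 2 → Smooth} (hw : Comp1 p w a) (hT : Comp3 p T t) :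
    Comp4 p (tmul w T) fun i j k l => a i * t j k l := by
  intro u X
  have h3 : (2 : Fin 3).succ = 3 := rfl
  rw [SphereFlow.tmul, hw, hT]
  simp [h3]
  ring

theorem Comp4.ring4 {T : TensorField 4} {t : Fin 2 → Fin 2 → Fin 2 → Fin 2 → Smooth}
    (h : Comp4 p T t) :
    Comp4 p (ring4 T) fun i j k l =>
      let e : Fin 2 → Fin 2 → Smooth := fun a b => C (1 / 3) * (t 0 0 a b + t 1 1 a b)
      t i j k l - ((if i = j then 1 else 0) * e k l + (if i = k then 1 else 0) * e l j
        + (if i = l then 1 else 0) * e j k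
        - C (1 / 2) * ((if k = l then 1 else 0) * e j i + (if l = j then 1 else 0) * e k i
        + (if j = k then 1 else 0) * e l i)) := by
  intro u X
  have h4 : lam u ^ 2 * ilam u ^ 2 = 1 := by rw [← mul_pow, lam_mul_ilam_apply u, one_pow]
  have he : ∀ X Y Y' Z : Tan (param p u), ⟪X, Y⟫ * (1 / 3 * SphereFlow.tr12 T (param p u) ![Y', Z]) =
      (coframe p 0 X u * coframe p 0 Y u + coframe p 1 X u * coframe p 1 Y u)
      * (1 / 3 * ∑ b, (∑ a, (t 0 0 a b + t 1 1 a b) u * coframe p a Y' u) * coframe p b Z u) := by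
    intro X Y Y' Z
    rw [inner_tan, h.tr12 u ![Y', Z]]
    simp
    linear_combination ((coframe p 0 X u * coframe p 0 Y u + coframe p 1 X u * coframe p 1 Y u)
      * (1 / 3) * (((t 0 0 0 0 u + t 1 1 0 0 u) * coframe p 0 Y' u
        + (t 0 0 1 0 u + t 1 1 1 0 u) * coframe p 1 Y' u) * coframe p 0 Z u
        + ((t 0 0 0 1 u + t 1 1 0 1 u) * coframe p 0 Y' u
        + (t 0 0 1 1 u + t 1 1 1 1 u) * coframe p 1 Y' u) * coframe p 1 Z u)) * h4
  have hf : ∀ X Y Y' Z : Tan (param p u),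
      ⟪X, Y⟫ * (-(1 / 2) * (1 / 3 * SphereFlow.tr12 T (param p u) ![Y', Z])) =
      -(1 / 2) * ((coframe p 0 X u * coframe p 0 Y u + coframe p 1 X u * coframe p 1 Y u)
      * (1 / 3 * ∑ b, (∑ a, (t 0 0 a b + t 1 1 a b) u * coframe p a Y' u) * coframe p b Z u)) := by
    intro X Y Y' Z
    rw [← he]
    ring
  -- The identity is checked for real numbers in place of the values of the coframe.
  have key : ∀ (t : Fin 2 → Fin 2 → Fin 2 → Fin 2 → ℝ) (x y z w : Fin 2 → ℝ),
      let e : Fin 2 → Fin 2 → ℝ := fun a b => 1 / 3 * (t 0 0 a b + t 1 1 a b)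
      let E : (Fin 2 → ℝ) → (Fin 2 → ℝ) → ℝ := fun y z =>
        1 / 3 * ∑ b, (∑ a, (t 0 0 a b + t 1 1 a b) * y a) * z b
      let g : (Fin 2 → ℝ) → (Fin 2 → ℝ) → ℝ := fun x y => x 0 * y 0 + x 1 * y 1
      ∑ l, (∑ k, (∑ j, (∑ i, t i j k l * x i) * y j) * z k) * w l
        - (g x y * E z w + g x z * E w y + g x w * E y z
          + -(1 / 2) * (g z w * E y x) + -(1 / 2) * (g w y * E z x) + -(1 / 2) * (g y z * E w x))
      = ∑ l, (∑ k, (∑ j, (∑ i, (t i j k l - ((if i = j then 1 else 0) * e k l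
        + (if i = k then 1 else 0) * e l j + (if i = l then 1 else 0) * e j k
        - 1 / 2 * ((if k = l then 1 else 0) * e j i + (if l = j then 1 else 0) * e k i
        + (if j = k then 1 else 0) * e l i))) * x i) * y j) * z k) * w l := by
    intro t x y z w
    simp
    ring
  simp only [SphereFlow.ring4, hf]
  simp only [he, h u X]
  have := key (fun i j k l => t i j k l u) (fun i => coframe p i (X 0) u)
    (fun i => coframe p i (X 1) u) (fun i => coframe p i (X 2) u) (fun i => coframe p i (X 3) u)
  simp only [sub_apply, add_apply, mul_apply, C_apply, Smooth.ite_apply]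
  exact this

/-! ### The trace-free part of the third derivative -/

/-- The components of a symmetric trace-free `3`-tensor with `000`-component `a` and
`001`-component `b`. -/
def cubic (a b : Smooth) (i j k : Fin 2) : Smooth :=
  (![![![a, b], ![b, -a]], ![![b, -a], ![-a, -b]]] : Fin 2 → Fin 2 → Fin 2 → Smooth) i j k

/-- The real part of `8 ∂_z³ w`. -/
def thirdRe (w : Smooth) : Smooth := D 0 (D 0 (D 0 w)) - C 3 * D 0 (D 1 (D 1 w))

/-- The imaginary part of `8 ∂_z³ w`, with the opposite sign. -/
def thirdIm (w : Smooth) : Smooth := C 3 * D 0 (D 0 (D 1 w)) - D 1 (D 1 (D 1 w))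

theorem D_lam_eq_phi (i : Fin 2) : D i lam = lam * phi i := by
  ext u; simp [phi]; ring

theorem D_phi (i j : Fin 2) :
    D i (phi j) = phi i * phi j - if i = j then C (1 / 2) * lam else 0 := by
  ext u
  fin_cases i <;> fin_cases j <;> simp [phi] <;> ring

theorem phi_sq_add (u : E2) : phi 0 u ^ 2 + phi 1 u ^ 2 = lam u - lam u ^ 2 := by
  have h := lam_mul_ilam_apply u
  rw [ilam_apply] at h
  rw [phi_apply, phi_apply]
  linear_combination lam u * h

/-- The components of the Hessian of the function `lam² w`. -/
def hessComp (w : Smooth) (i j : Fin 2) : Smooth :=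
  lam ^ 2 * (D i (D j w) + phi i * D j w + phi j * D i w + C 2 * phi i * phi j * w
    + if i = j then phi 0 * D 0 w + phi 1 * D 1 w + lam * w - C 2 * lam ^ 2 * w else 0)

theorem hess_comp {v : S2 → ℝ} {w : Smooth} (h : ∀ u, v (param p u) = lam u ^ 2 * w u) :
    Comp2 p (hess v) (hessComp w) := by
  have h0 : Comp0 p (ofFun v) (lam ^ 2 * w) := fun u X => h u
  have h2 := h0.nabla.nabla
  convert! h2 using 1
  funext i j
  ext u
  have hp := phi_sq_add u
  fin_cases i <;> fin_cases j <;>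
    simp [hessComp, chris, D_lam_eq_phi, D_phi, -D_lam]
  · linear_combination (-2 * lam u ^ 2 * w u) * hp
  · ring
  · ring
  · linear_combination (-2 * lam u ^ 2 * w u) * hp

/-- The components of the third covariant derivative of the function `lam² w`. -/
def thirdComp (w : Smooth) (i j k : Fin 2) : Smooth :=
  D i (hessComp w j k) - (chris 0 i j * hessComp w 0 k + chris 1 i j * hessComp w 1 k)
    - (chris 0 i k * hessComp w j 0 + chris 1 i k * hessComp w j 1)

/-- With `thirdIm_eq`, this is the conformal covariance of the trace-free third derivative (Bol's
lemma): all lower order terms cancel, and what remains is the flat third derivative of `w`. -/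
theorem thirdRe_eq (w : Smooth) (u : E2) :
    thirdComp w 0 0 0 u - thirdComp w 0 1 1 u - thirdComp w 1 0 1 u - thirdComp w 1 1 0 u =
      lam u ^ 2 * thirdRe w u := by
  simp [thirdComp, hessComp, chris, thirdRe, D_lam_eq_phi, D_phi, -D_lam]
  ring

theorem thirdIm_eq (w : Smooth) (u : E2) :
    thirdComp w 0 0 1 u + thirdComp w 0 1 0 u + thirdComp w 1 0 0 u - thirdComp w 1 1 1 u =
      lam u ^ 2 * thirdIm w u := by
  simp [thirdComp, hessComp, chris, thirdIm, D_lam_eq_phi, D_phi, -D_lam]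
  ring

/-- The trace-free part of the third covariant derivative of `v` is conformally
the flat one of `w`. -/
theorem TFb_comp {v : S2 → ℝ} {w : Smooth} (h : ∀ u, v (param p u) = lam u ^ 2 * w u) :
    Comp3 p (TFb v) fun i j k => C (1 / 4) * lam ^ 2 * cubic (thirdRe w) (thirdIm w) i j k := by
  have h3 : Comp3 p (nabla (hess v)) (thirdComp w) := (hess_comp h).nabla
  convert! h3.symm3.TF3 using 1
  funext i j k
  ext u
  have hre := thirdRe_eq w u
  have him := thirdIm_eq w u
  fin_cases i <;> fin_cases j <;> fin_cases k <;> simp [cubic]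
  · linear_combination (-1 / 4) * hre
  · linear_combination (-1 / 4) * him
  · linear_combination (-1 / 4) * him
  · linear_combination (1 / 4) * hre
  · linear_combination (-1 / 4) * him
  · linear_combination (1 / 4) * hre
  · linear_combination (1 / 4) * hre
  · linear_combination (1 / 4) * him

/-! ### The Laplacian, the flow and `Q` in terms of the weighted function -/

theorem lap_comp {v : S2 → ℝ} {f : Smooth} (h : ∀ u, v (param p u) = f u) (u : E2) :
    lap v (param p u) = ilam u ^ 2 * (D 0 (D 0 f) u + D 1 (D 1 f) u) := by
  have h0 : Comp0 p (ofFun v) f := fun u X => h u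
  rw [lap, hess, h0.nabla.nabla.tr12 u]
  simp [chris]
  left
  ring

theorem lap_center {v : S2 → ℝ} {f : Smooth} (h : ∀ u, v (param p u) = f u) :
    lap v p = D 0 (D 0 f) 0 + D 1 (D 1 f) 0 := by
  have := lap_comp h 0
  rw [param_zero] at this
  rw [this]
  simp

theorem lap_weighted {v : S2 → ℝ} {w : Smooth} (h : ∀ u, v (param p u) = lam u ^ 2 * w u)
    (u : E2) :
    lap v (param p u) = (D 0 (D 0 w) + D 1 (D 1 w) + C 4 * (phi 0 * D 0 w + phi 1 * D 1 w)
      + (C 4 * lam - C 6 * lam ^ 2) * w) u := by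
  have hp := phi_sq_add u
  have hl : ilam u ^ 2 * lam u ^ 2 = 1 := by
    rw [mul_comm, ← mul_pow, lam_mul_ilam_apply, one_pow]
  rw [lap_comp (f := lam ^ 2 * w) h]
  have : D 0 (D 0 (lam ^ 2 * w)) u + D 1 (D 1 (lam ^ 2 * w)) u =
      lam u ^ 2 * (D 0 (D 0 w) + D 1 (D 1 w) + C 4 * (phi 0 * D 0 w + phi 1 * D 1 w)
      + (C 4 * lam - C 6 * lam ^ 2) * w) u := by
    simp [D_lam_eq_phi, D_phi, -D_lam]
    linear_combination (6 * lam u ^ 2 * w u) * hp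
  rw [this, ← mul_assoc, hl, one_mul]

/-- The time derivative prescribed by the Ricci flow, in terms of the weighted function `w`. -/
theorem flow_weighted {v : S2 → ℝ} {w : Smooth} (h : ∀ u, v (param p u) = lam u ^ 2 * w u)
    (u : E2) :
    v (param p u) * lap v (param p u) - normSq (nabla (ofFun v)) (param p u)
      + 2 * v (param p u) ^ 2 =
    lam u ^ 2 * (w * (D 0 (D 0 w) + D 1 (D 1 w)) - D 0 w ^ 2 - D 1 w ^ 2) u := by
  have h0 : Comp0 p (ofFun v) (lam ^ 2 * w) := fun u X => h u
  have hp := phi_sq_add u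
  have hl : ilam u ^ 2 * lam u ^ 2 = 1 := by
    rw [mul_comm, ← mul_pow, lam_mul_ilam_apply, one_pow]
  rw [lap_weighted h, h0.nabla.normSq, h]
  simp [D_lam_eq_phi, -D_lam]
  linear_combination (-lam u ^ 2 * ((D 0 w u + 2 * phi 0 u * w u) ^ 2
    + (D 1 w u + 2 * phi 1 u * w u) ^ 2)) * hl - 4 * lam u ^ 2 * w u ^ 2 * hp

/-- The quantity `Q` in terms of the weighted function `w`: the conformal factors cancel. -/
def flatQ (w : Smooth) : Smooth := C (1 / 4) * (w * (thirdRe w ^ 2 + thirdIm w ^ 2))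

theorem Q_weighted {v : S2 → ℝ} {w : Smooth} (h : ∀ u, v (param p u) = lam u ^ 2 * w u)
    (u : E2) : Q v (param p u) = flatQ w u := by
  have hl : ilam u ^ 6 * lam u ^ 6 = 1 := by
    rw [mul_comm, ← mul_pow, lam_mul_ilam_apply, one_pow]
  rw [Q, (TFb_comp h).normSq, h]
  simp [flatQ, cubic]
  linear_combination (1 / 4 * w u * (thirdRe w u ^ 2 + thirdIm w u ^ 2)) * hl

/-- The function `Δv + 6v` in terms of the weighted function `w`. -/
def lapSix (w : Smooth) : Smooth :=
  D 0 (D 0 w) + D 1 (D 1 w) + C 4 * (phi 0 * D 0 w + phi 1 * D 1 w) + C 4 * lam * w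

theorem lapSix_apply {v : S2 → ℝ} {w : Smooth} (h : ∀ u, v (param p u) = lam u ^ 2 * w u)
    (u : E2) : lap v (param p u) + 6 * v (param p u) = lapSix w u := by
  rw [lap_weighted h, h]
  simp [lapSix]
  ring

@[simp] theorem phi_zero (i : Fin 2) : phi i 0 = 0 := by simp [phi]

/-- With `D_D_lapSix`, the trace-free Hessian of `Δv + 6v` at the centre is the flat one of `Δw`:
the second order terms cancel because of the multiple `6v`. -/
theorem D_D_lapSix_sub (w : Smooth) :
    D 0 (D 0 (lapSix w)) 0 - D 1 (D 1 (lapSix w)) 0 =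
      D 0 (D 0 (D 0 (D 0 w))) 0 - D 1 (D 1 (D 1 (D 1 w))) 0 := by
  simp only [lapSix, D_add, D_mul, D_C, D_phi, D_lam_eq_phi, D_sub, add_apply, mul_apply, sub_apply,
    phi_zero, lam_zero, D_one_zero, zero_apply, C_apply]
  simp
  ring

theorem D_D_lapSix (w : Smooth) :
    D 0 (D 1 (lapSix w)) 0 = D 0 (D 0 (D 0 (D 1 w))) 0 + D 0 (D 1 (D 1 (D 1 w))) 0 := by
  simp only [lapSix, D_add, D_mul, D_C, D_phi, D_lam_eq_phi, D_sub, add_apply, mul_apply, sub_apply,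
    phi_zero, lam_zero, D_one_zero, zero_apply, C_apply]
  simp
  ring

/-! ### The two quadratic terms at the centre of the coordinates -/

theorem normSq_hessTerm {v : S2 → ℝ} {w : Smooth} (h : ∀ u, v (param p u) = lam u ^ 2 * w u) :
    normSq (hessTerm v) p =
      1 / 2 * (w 0 * (D 0 (D 0 (D 0 (D 0 w))) 0 - D 1 (D 1 (D 1 (D 1 w))) 0)
        - (D 0 w 0 * thirdRe w 0 + D 1 w 0 * thirdIm w 0)) ^ 2
      + 1 / 2 * (2 * w 0 * (D 0 (D 0 (D 0 (D 1 w))) 0 + D 0 (D 1 (D 1 (D 1 w))) 0)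
        - (D 0 w 0 * thirdIm w 0 - D 1 w 0 * thirdRe w 0)) ^ 2 := by
  have h0 : Comp0 p (ofFun v) (lam ^ 2 * w) := fun u X => h u
  have h1 : Comp0 p (ofFun fun y => lap v y + 6 * v y) (lapSix w) := fun u X => lapSix_apply h u
  have h2 := h1.nabla.nabla.TF2
  have h3 := (h0.nabla.tmul (TFb_comp h)).tr12
  -- Only the values of the components at the centre enter the norm.
  obtain ⟨t, ht⟩ : ∃ t, t = fun i j => lam ^ 2 * w * (fun i j =>
    D i (D j (lapSix w)) - (chris 0 i j * D 0 (lapSix w) + chris 1 i j * D 1 (lapSix w))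
      - C (1 / 2) * (D 0 (D 0 (lapSix w))
        - (chris 0 0 0 * D 0 (lapSix w) + chris 1 0 0 * D 1 (lapSix w)) + (D 1 (D 1 (lapSix w))
        - (chris 0 1 1 * D 0 (lapSix w) + chris 1 1 1 * D 1 (lapSix w))))
        * (if i = j then 1 else 0)) i j - C 2 * (fun k l => ilam ^ 2 *
      (D 0 (lam ^ 2 * w) * (C (1 / 4) * lam ^ 2 * cubic (thirdRe w) (thirdIm w) 0 k l)
      + D 1 (lam ^ 2 * w) * (C (1 / 4) * lam ^ 2 * cubic (thirdRe w) (thirdIm w) 1 k l))) i j :=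
    ⟨_, rfl⟩
  have h4 : Comp2 p (hessTerm v) t := by
    intro u X
    rw [hessTerm, hess, h2 u X, h3 u X, h u, ht]
    simp only [sub_apply, mul_apply, pow_apply, C_apply, Fin.sum_univ_two]
    ring
  have h5 := h4.normSq 0
  rw [param_zero] at h5
  have e1 := D_D_lapSix_sub w
  have e2 := D_D_lapSix w
  have t00 : t 0 0 0 = 1 / 2 * (w 0 * (D 0 (D 0 (D 0 (D 0 w))) 0 - D 1 (D 1 (D 1 (D 1 w))) 0)
      - (D 0 w 0 * thirdRe w 0 + D 1 w 0 * thirdIm w 0)) := by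
    rw [ht, ← e1]; simp [cubic]; ring
  have t01 : t 0 1 0 = 1 / 2 * (2 * w 0 * (D 0 (D 0 (D 0 (D 1 w))) 0 + D 0 (D 1 (D 1 (D 1 w))) 0)
      - (D 0 w 0 * thirdIm w 0 - D 1 w 0 * thirdRe w 0)) := by
    rw [ht, ← e2]; simp [cubic]; ring
  have t10 : t 1 0 0 = t 0 1 0 := by rw [ht]; simp [cubic]
  have t11 : t 1 1 0 = - t 0 0 0 := by rw [ht]; simp [cubic]; ring
  rw [h5]
  simp only [Fin.sum_univ_two, t11, t10, t01, t00, ilam_zero]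
  ring

theorem normSq_gradTerm {v : S2 → ℝ} {w : Smooth} (h : ∀ u, v (param p u) = lam u ^ 2 * w u) :
    normSq (gradTerm v) p =
      1 / 8 * (w 0 * (D 0 (thirdRe w) 0 - D 1 (thirdIm w) 0)
        + 2 * (D 0 w 0 * thirdRe w 0 - D 1 w 0 * thirdIm w 0)) ^ 2
      + 1 / 8 * (w 0 * (D 1 (thirdRe w) 0 + D 0 (thirdIm w) 0)
        + 2 * (D 1 w 0 * thirdRe w 0 + D 0 w 0 * thirdIm w 0)) ^ 2 := by
  have h0 : Comp0 p (ofFun v) (lam ^ 2 * w) := fun u X => h u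
  have h2 := (TFb_comp h).nabla
  have h3 := h0.nabla.tmul (TFb_comp h)
  obtain ⟨c, hc⟩ : ∃ c : Fin 2 → Fin 2 → Fin 2 → Fin 2 → Smooth, c = fun i j k l =>
    lam ^ 2 * w * (fun i j k l => D i (C (1 / 4) * lam ^ 2 * cubic (thirdRe w) (thirdIm w) j k l)
      - (chris 0 i j * (C (1 / 4) * lam ^ 2 * cubic (thirdRe w) (thirdIm w) 0 k l)
        + chris 1 i j * (C (1 / 4) * lam ^ 2 * cubic (thirdRe w) (thirdIm w) 1 k l))
      - (chris 0 i k * (C (1 / 4) * lam ^ 2 * cubic (thirdRe w) (thirdIm w) j 0 l)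
        + chris 1 i k * (C (1 / 4) * lam ^ 2 * cubic (thirdRe w) (thirdIm w) j 1 l))
      - (chris 0 i l * (C (1 / 4) * lam ^ 2 * cubic (thirdRe w) (thirdIm w) j k 0)
        + chris 1 i l * (C (1 / 4) * lam ^ 2 * cubic (thirdRe w) (thirdIm w) j k 1))) i j k l
      + C 2 * (D i (lam ^ 2 * w) * (C (1 / 4) * lam ^ 2 * cubic (thirdRe w) (thirdIm w) j k l)) :=
    ⟨_, rfl⟩
  have h4 : Comp4 p (fun x X => v x * nabla (TFb v) x X + 2 * tmul (nabla (ofFun v)) (TFb v) x X)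
      c := by
    intro u X
    dsimp only
    rw [h2 u X, h3 u X, h u, hc]
    simp only [Smooth.sub_apply, Smooth.add_apply, mul_apply, pow_apply, C_apply, Fin.sum_univ_two]
    ring
  have h5 := h4.ring4.normSq 0
  rw [param_zero] at h5
  -- For each `i` the last three slots of `c` form a symmetric trace-free tensor, which is
  -- determined by its values `c i 0 0 0 = a i` and `c i 0 0 1 = b i` at the centre.
  obtain ⟨a, ha⟩ : ∃ a : Fin 2 → ℝ, a = fun i =>
    1 / 4 * (w 0 * D i (thirdRe w) 0 + 2 * D i w 0 * thirdRe w 0) := ⟨_, rfl⟩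
  obtain ⟨b, hb⟩ : ∃ b : Fin 2 → ℝ, b = fun i =>
    1 / 4 * (w 0 * D i (thirdIm w) 0 + 2 * D i w 0 * thirdIm w 0) := ⟨_, rfl⟩
  have key : ∀ i j k l, c i j k l 0 =
      (![![![a i, b i], ![b i, -a i]], ![![b i, -a i], ![-a i, -b i]]] :
        Fin 2 → Fin 2 → Fin 2 → ℝ) j k l := by
    intro i j k l
    rw [hc, ha, hb]
    fin_cases j <;> fin_cases k <;> fin_cases l <;> simp [cubic] <;> ring
  rw [gradTerm, h5]
  simp only [Smooth.sub_apply, Smooth.add_apply, mul_apply, C_apply, key, ilam_zero]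
  have e1 : w 0 * (D 0 (thirdRe w) 0 - D 1 (thirdIm w) 0)
        + 2 * (D 0 w 0 * thirdRe w 0 - D 1 w 0 * thirdIm w 0) = 4 * (a 0 - b 1) := by
    rw [ha, hb]; ring
  have e2 : w 0 * (D 1 (thirdRe w) 0 + D 0 (thirdIm w) 0)
        + 2 * (D 1 w 0 * thirdRe w 0 + D 0 w 0 * thirdIm w 0) = 4 * (a 1 + b 0) := by
    rw [ha, hb]; ring
  rw [e1, e2]
  simp [Fin.sum_univ_two]
  ring

/-! ### The evolution equation at the centre of the coordinates -/

/-- The right-hand side of the Ricci flow equation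
`∂w/∂t = w Δw - |∇w|²` of the weighted function. -/
def flowRhs (w : Smooth) : Smooth := w * (D 0 (D 0 w) + D 1 (D 1 w)) - D 0 w ^ 2 - D 1 w ^ 2

/-- With `thirdIm_flowRhs`, the evolution of the trace-free third derivative under the flow. -/
theorem thirdRe_flowRhs (w : Smooth) (u : E2) :
    thirdRe (flowRhs w) u = w u * (D 0 (D 0 (thirdRe w)) u + D 1 (D 1 (thirdRe w)) u)
      + 2 * (D 0 w u * (D 0 (thirdRe w) u + D 1 (thirdIm w) u)
        + D 1 w u * (D 1 (thirdRe w) u - D 0 (thirdIm w) u))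
      - (D 0 w u * (D 0 (thirdRe w) u - D 1 (thirdIm w) u)
        + D 1 w u * (D 1 (thirdRe w) u + D 0 (thirdIm w) u))
      - 2 * (D 0 (D 0 w) u + D 1 (D 1 w) u) * thirdRe w u := by
  simp [thirdRe, thirdIm, flowRhs]
  ring

theorem thirdIm_flowRhs (w : Smooth) (u : E2) :
    thirdIm (flowRhs w) u = w u * (D 0 (D 0 (thirdIm w)) u + D 1 (D 1 (thirdIm w)) u)
      - 2 * (D 0 w u * (D 1 (thirdRe w) u - D 0 (thirdIm w) u)
        - D 1 w u * (D 0 (thirdRe w) u + D 1 (thirdIm w) u))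
      - (D 0 w u * (D 1 (thirdRe w) u + D 0 (thirdIm w) u)
        - D 1 w u * (D 0 (thirdRe w) u - D 1 (thirdIm w) u))
      - 2 * (D 0 (D 0 w) u + D 1 (D 1 w) u) * thirdIm w u := by
  simp [thirdRe, thirdIm, flowRhs]
  ring

/-- The evolution equation of `Q` at the centre of the coordinates. On the left is the derivative of
`flatQ` at `w` in the direction of `flowRhs w`. -/
theorem evolution_center {v : S2 → ℝ} {w : Smooth} (h : ∀ u, v (param p u) = lam u ^ 2 * w u)
    (hw : w 0 ≠ 0) :
    1 / 4 * (flowRhs w 0 * (thirdRe w 0 ^ 2 + thirdIm w 0 ^ 2)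
      + w 0 * (2 * thirdRe w 0 * thirdRe (flowRhs w) 0
        + 2 * thirdIm w 0 * thirdIm (flowRhs w) 0)) =
    v p * lap (Q v) p - 4 * (D 0 (D 0 w) 0 + D 1 (D 1 w) 0 - (D 0 w 0 ^ 2 + D 1 w 0 ^ 2) / w 0)
      * Q v p - 2 * normSq (gradTerm v) p - (1 / 2) * normSq (hessTerm v) p := by
  have hv : v p = w 0 := by
    have := h 0
    rw [param_zero] at this
    simpa using this
  have hQ : Q v p = 1 / 4 * (w 0 * (thirdRe w 0 ^ 2 + thirdIm w 0 ^ 2)) := by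
    have := Q_weighted h 0
    rw [param_zero] at this
    rw [this]
    rfl
  have hlap := lap_center (Q_weighted h)
  have hdiv : (D 0 w 0 ^ 2 + D 1 w 0 ^ 2) / w 0 * w 0 = D 0 w 0 ^ 2 + D 1 w 0 ^ 2 :=
    div_mul_cancel₀ _ hw
  have e1 : D 0 (D 0 (D 0 (D 0 w))) 0 - D 1 (D 1 (D 1 (D 1 w))) 0 =
      D 0 (thirdRe w) 0 + D 1 (thirdIm w) 0 := by
    simp [thirdRe, thirdIm]
  have e2 : 2 * w 0 * (D 0 (D 0 (D 0 (D 1 w))) 0 + D 0 (D 1 (D 1 (D 1 w))) 0) =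
      w 0 * (D 0 (thirdIm w) 0 - D 1 (thirdRe w) 0) := by
    simp [thirdRe, thirdIm]
    ring
  have hf : flowRhs w 0 = w 0 * (D 0 (D 0 w) 0 + D 1 (D 1 w) 0) - D 0 w 0 ^ 2 - D 1 w 0 ^ 2 := rfl
  rw [normSq_gradTerm h, normSq_hessTerm h, e1, e2, thirdRe_flowRhs, thirdIm_flowRhs, hf, hlap, hQ,
    hv]
  simp [flatQ]
  linear_combination (-(thirdRe w 0 ^ 2 + thirdIm w 0 ^ 2)) * hdiv

/-! ### Curvature of conformal metrics -/

theorem inCoord_confMetric {v : S2 → ℝ} {w g : Smooth} (h : ∀ u, v (param p u) = lam u ^ 2 * w u)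
    (hg : ∀ u, w u * g u = 1) (u : E2) :
    inCoord (confMetric v) p u = Matrix.diagonal fun _ => g u := by
  have hl := lam_pos u
  have hw : w u ≠ 0 := left_ne_zero_of_mul_eq_one (hg u)
  have hgu : g u = (w u)⁻¹ := eq_inv_of_mul_eq_one_right (hg u)
  ext i j
  simp only [inCoord, confMetric, Matrix.of_apply, Matrix.cons_val_zero, Matrix.cons_val_one,
    Submodule.coe_inner, coe_coordVec, inner_cvec, h, Matrix.diagonal_apply, hgu]
  split_ifs
  · field_simp
  · simp

theorem inv_inCoord_confMetric {v : S2 → ℝ} {w g : Smooth}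
    (h : ∀ u, v (param p u) = lam u ^ 2 * w u) (hg : ∀ u, w u * g u = 1) (u : E2) :
    (inCoord (confMetric v) p u)⁻¹ = Matrix.diagonal fun _ => w u := by
  rw [inCoord_confMetric h hg]
  apply Matrix.inv_eq_right_inv
  rw [Matrix.diagonal_mul_diagonal, ← Matrix.diagonal_one]
  congr 1
  ext
  rw [mul_comm, hg]

/-- The Christoffel symbols of the metric `w⁻¹ (du₀² + du₁²)`, where `g = w⁻¹`. -/
def confChris (w g : Smooth) (k i j : Fin 2) : Smooth :=
  C (-1 / 2) * g * ((if k = j then D i w else 0) + (if k = i then D j w else 0)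
    - (if i = j then D k w else 0))

theorem D_of_mul_eq_one {w g : Smooth} (hg : ∀ u, w u * g u = 1) (i : Fin 2) :
    D i g = -(g ^ 2 * D i w) := by
  have h1 : w * g = 1 := ext hg
  have h := congrArg (D i) h1
  ext u
  have h2 := congrFun (congrArg Subtype.val h) u
  simp at h2 ⊢
  linear_combination g u * h2 - D i g u * hg u

theorem christoffel_confMetric {v : S2 → ℝ} {w g : Smooth}
    (h : ∀ u, v (param p u) = lam u ^ 2 * w u) (hg : ∀ u, w u * g u = 1) (k i j : Fin 2) :
    christoffel (inCoord (confMetric v) p) k i j = (confChris w g k i j).1 := by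
  ext u
  have hpd : ∀ a b c : Fin 2, pd a (fun x => inCoord (confMetric v) p x b c) u =
      if b = c then D a g u else 0 := by
    intro a b c
    split_ifs with hbc
    · rw [D_apply]
      congr 1
      ext x
      rw [inCoord_confMetric h hg, hbc, Matrix.diagonal_apply_eq]
    · have : (fun x => inCoord (confMetric v) p x b c) = fun _ => 0 := by
        ext x
        rw [inCoord_confMetric h hg, Matrix.diagonal_apply_ne _ hbc]
      rw [this]
      simp [pd]
  rw [christoffel, inv_inCoord_confMetric h hg]
  simp only [hpd, D_of_mul_eq_one hg, confChris]
  have e := hg u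
  fin_cases k <;> fin_cases i <;> fin_cases j <;> simp <;>
    first
    | linear_combination (-1 / 2 * g u * D 0 w u) * e
    | linear_combination (-1 / 2 * g u * D 1 w u) * e
    | linear_combination (1 / 2 * g u * D 0 w u) * e
    | linear_combination (1 / 2 * g u * D 1 w u) * e

theorem ricci_confMetric {v : S2 → ℝ} {w g : Smooth}
    (h : ∀ u, v (param p u) = lam u ^ 2 * w u) (hg : ∀ u, w u * g u = 1) (i j : Fin 2) :
    ricci (confMetric v) p i j = if i = j then 1 / 2 * (g 0 * (D 0 (D 0 w) 0 + D 1 (D 1 w) 0)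
      - g 0 ^ 2 * (D 0 w 0 ^ 2 + D 1 w 0 ^ 2)) else 0 := by
  rw [ricci, ricciCoord, chart_self]
  simp only [christoffel_confMetric h hg, ← D_apply]
  have hD := D_of_mul_eq_one hg
  fin_cases i <;> fin_cases j <;> simp [confChris, hD] <;> ring

theorem scal_confMetric {v : S2 → ℝ} {w : Smooth}
    (h : ∀ u, v (param p u) = lam u ^ 2 * w u) (hw : ∀ u, w u ≠ 0) :
    scal (confMetric v) p =
      D 0 (D 0 w) 0 + D 1 (D 1 w) 0 - (D 0 w 0 ^ 2 + D 1 w 0 ^ 2) / w 0 := by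
  let g : Smooth := ⟨fun u => (w u)⁻¹, mem_iff.2 ((smooth w).inv hw)⟩
  have hg : ∀ u, w u * g u = 1 := fun u => mul_inv_cancel₀ (hw u)
  rw [scal, chart_self, inv_inCoord_confMetric h hg]
  have e : g 0 = (w 0)⁻¹ := rfl
  have := hw 0
  simp [ricci_confMetric h hg, e]
  field_simp

/-! ### Time derivatives -/

/-- Partial derivatives in space commute with the derivative in time. -/
theorem hasDerivAt_D {I : Set ℝ} (hI : IsOpen I) {w w' : ℝ → Smooth}
    (hs : ContDiffOn ℝ ∞ (fun z : ℝ × E2 => w z.1 z.2) (I ×ˢ Set.univ))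
    (hd : ∀ t ∈ I, ∀ u, HasDerivAt (fun s => w s u) (w' t u) t) (i : Fin 2) :
    ContDiffOn ℝ ∞ (fun z : ℝ × E2 => D i (w z.1) z.2) (I ×ˢ Set.univ) ∧
      ∀ t ∈ I, ∀ u, HasDerivAt (fun s => D i (w s) u) (D i (w' t) u) t := by
  set F : ℝ × E2 → ℝ := fun z => w z.1 z.2 with hF
  have hO : IsOpen (I ×ˢ (Set.univ : Set E2)) := hI.prod isOpen_univ
  have hdF : ∀ t ∈ I, ∀ u, DifferentiableAt ℝ F (t, u) := fun t ht u =>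
    (hs.contDiffAt (hO.mem_nhds ⟨ht, trivial⟩)).differentiableAt (by simp)
  have hfs : ContDiffOn ℝ ∞ (fderiv ℝ F) (I ×ˢ Set.univ) := hs.fderiv_of_isOpen hO (by simp)
  have hdfF : ∀ t ∈ I, ∀ u, DifferentiableAt ℝ (fderiv ℝ F) (t, u) := fun t ht u =>
    (hfs.contDiffAt (hO.mem_nhds ⟨ht, trivial⟩)).differentiableAt (by simp)
  set e : ℝ × E2 := (0, EuclideanSpace.single i 1) with he
  have hspace : ∀ t ∈ I, ∀ u, D i (w t) u = fderiv ℝ F (t, u) e := by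
    intro t ht u
    have h1 : HasFDerivAt (fun y : E2 => F (t, y))
        ((fderiv ℝ F (t, u)).comp (ContinuousLinearMap.inr ℝ ℝ E2)) u :=
      (hdF t ht u).hasFDerivAt.comp u (hasFDerivAt_prodMk_right t u)
    change fderiv ℝ (fun y : E2 => F (t, y)) u _ = _
    rw [h1.fderiv]
    simp [he]
  have hline : ∀ (t : ℝ) (u : E2), HasDerivAt (fun s : ℝ => (s, u)) ((1, 0) : ℝ × E2) t :=
    fun t u => (hasDerivAt_id' t).prodMk (hasDerivAt_const t u)
  have htime : ∀ t ∈ I, ∀ u, w' t u = fderiv ℝ F (t, u) (1, 0) := by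
    intro t ht u
    exact (hd t ht u).unique (HasFDerivAt.comp_hasDerivAt (l := F) (f := fun s : ℝ => (s, u)) t
      (hdF t ht u).hasFDerivAt (hline t u))
  refine ⟨?_, ?_⟩
  · refine ContDiffOn.congr (f := fun z => fderiv ℝ F z e) ?_ ?_
    · exact hfs.clm_apply contDiffOn_const
    · rintro ⟨t, u⟩ ⟨ht, -⟩
      exact hspace t ht u
  · intro t ht u
    have h2 : HasFDerivAt (fun z => fderiv ℝ F z e)
        ((fderiv ℝ (fderiv ℝ F) (t, u)).flip e) (t, u) :=
      ((ContinuousLinearMap.apply ℝ ℝ e).hasFDerivAt).comp (t, u) (hdfF t ht u).hasFDerivAt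
    have h3 : HasDerivAt (fun s : ℝ => fderiv ℝ F (s, u) e)
        ((fderiv ℝ (fderiv ℝ F) (t, u)).flip e (1, 0)) t :=
      HasFDerivAt.comp_hasDerivAt (f := fun s : ℝ => (s, u)) t h2 (hline t u)
    have h4 : D i (w' t) u = fderiv ℝ (fderiv ℝ F) (t, u) e (1, 0) := by
      have h5 : HasFDerivAt (fun z => fderiv ℝ F z (1, 0))
          ((fderiv ℝ (fderiv ℝ F) (t, u)).flip (1, 0)) (t, u) :=
        ((ContinuousLinearMap.apply ℝ ℝ ((1, 0) : ℝ × E2)).hasFDerivAt).comp (t, u)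
          (hdfF t ht u).hasFDerivAt
      have h6 : HasFDerivAt (fun y : E2 => fderiv ℝ F (t, y) (1, 0))
          (((fderiv ℝ (fderiv ℝ F) (t, u)).flip (1, 0)).comp (ContinuousLinearMap.inr ℝ ℝ E2)) u :=
        h5.comp u (hasFDerivAt_prodMk_right t u)
      have h7 : (w' t).1 = fun y : E2 => fderiv ℝ F (t, y) (1, 0) := funext (htime t ht)
      rw [D_apply, pd, h7, h6.fderiv]
      simp [he]
    have hsymm := ((hs.contDiffAt (hO.mem_nhds (x := (t, u)) ⟨ht, trivial⟩)).isSymmSndFDerivAt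
      (by simp; exact WithTop.coe_le_coe.2 le_top)).eq e (1, 0)
    rw [h4, hsymm]
    refine (h3.congr_deriv (by simp)).congr_of_eventuallyEq ?_
    filter_upwards [hI.mem_nhds ht] with s hs'
    exact hspace s hs' u

/-! ### The evolution of `Q` along a conformal Ricci flow -/

theorem inCoord_confMetric_center (v : S2 → ℝ) (i j : Fin 2) :
    inCoord (confMetric v) p (chartAt E2 p p) i j = if i = j then (v p)⁻¹ else 0 := by
  rw [chart_self]
  simp only [inCoord, confMetric, Matrix.of_apply, Matrix.cons_val_zero, Matrix.cons_val_one,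
    Submodule.coe_inner, coe_coordVec, inner_cvec, param_zero, lam_zero]
  split_ifs <;> simp

theorem contMDiff_param (p : S2) : ContMDiff 𝓘(ℝ, E2) (𝓡 2) ∞ (param p) := by
  have h := contMDiffOn_chart_symm (I := 𝓡 2) (n := ∞) (x := p)
  have ht : (chartAt E2 p).target = Set.univ := by
    have := fact_finrank_E3
    exact stereographic'_target (-p)
  rw [ht] at h
  exact contMDiffOn_univ.1 h

/-- The weighted functions `w = lam⁻² v` of a family of functions smooth in space and time. -/
theorem exists_weighted {I : Set ℝ} {v : ℝ → S2 → ℝ}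
    (hv : ContMDiffOn (𝓘(ℝ, ℝ).prod (𝓡 2)) 𝓘(ℝ, ℝ) ∞ (fun z : ℝ × S2 => v z.1 z.2)
      (I ×ˢ Set.univ)) (p : S2) :
    ∃ w : ℝ → Smooth, (∀ t ∈ I, ∀ u, v t (param p u) = lam u ^ 2 * w t u) ∧
      ContDiffOn ℝ ∞ (fun z : ℝ × E2 => w z.1 z.2) (I ×ˢ Set.univ) := by
  classical
  have h1 : ContDiffOn ℝ ∞ (fun z : ℝ × E2 => v z.1 (param p z.2)) (I ×ˢ Set.univ) := by
    rw [← contMDiffOn_iff_contDiffOn]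
    have hm : ContMDiff 𝓘(ℝ, ℝ × E2) (𝓘(ℝ, ℝ).prod (𝓡 2)) ∞
        (fun z : ℝ × E2 => (z.1, param p z.2)) :=
      contDiff_fst.contMDiff.prodMk ((contMDiff_param p).comp contDiff_snd.contMDiff)
    exact hv.comp hm.contMDiffOn fun z hz => ⟨hz.1, trivial⟩
  have h2 : ContDiffOn ℝ ∞ (fun z : ℝ × E2 => ilam z.2 ^ 2 * v z.1 (param p z.2))
      (I ×ˢ Set.univ) := by
    have hl : ContDiff ℝ ∞ fun z : ℝ × E2 => ilam z.2 ^ 2 := (smooth (ilam ^ 2)).comp contDiff_snd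
    exact hl.contDiffOn.mul h1
  have h3 : ∀ t ∈ I, ContDiff ℝ ∞ fun u => ilam u ^ 2 * v t (param p u) := by
    intro t ht
    have hm : ContDiff ℝ ∞ fun u : E2 => (t, u) := contDiff_prodMk_right t
    exact contDiffOn_univ.1 (ContDiffOn.comp (f := fun u : E2 => (t, u)) h2 hm.contDiffOn
      fun u _ => ⟨ht, trivial⟩)
  refine ⟨fun t => if ht : t ∈ I then ⟨_, mem_iff.2 (h3 t ht)⟩ else 0, ?_, ?_⟩
  · intro t ht u
    simp only [dif_pos ht]
    rw [← mul_assoc, ← mul_pow, lam_mul_ilam_apply, one_pow, one_mul]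
  · refine h2.congr ?_
    rintro ⟨t, u⟩ ⟨ht, -⟩
    simp only [dif_pos ht]

theorem weighted_pos {v : S2 → ℝ} {w : Smooth} (h : ∀ u, v (param p u) = lam u ^ 2 * w u)
    (hv : ∀ x, 0 < v x) (u : E2) : 0 < w u := by
  have h1 := hv (param p u)
  rw [h] at h1
  exact pos_of_mul_pos_right h1 (by positivity)

theorem eq_weighted_zero {v : S2 → ℝ} {w : Smooth} (h : ∀ u, v (param p u) = lam u ^ 2 * w u) :
    v p = w 0 := by
  have := h 0
  rw [param_zero] at this
  simpa using this

/-- The right-hand side of the Ricci flow equation in terms of the weighted function. -/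
theorem ricci_weighted {v : S2 → ℝ} {w : Smooth} (h : ∀ u, v (param p u) = lam u ^ 2 * w u)
    (hw : ∀ u, w u ≠ 0) (i j : Fin 2) :
    -2 * ricci (confMetric v) p i j = if i = j then -flowRhs w 0 / v p ^ 2 else 0 := by
  let g : Smooth := ⟨fun u => (w u)⁻¹, mem_iff.2 ((smooth w).inv hw)⟩
  have hg : ∀ u, w u * g u = 1 := fun u => mul_inv_cancel₀ (hw u)
  have e : g 0 = (w 0)⁻¹ := rfl
  have hw0 := hw 0
  rw [ricci_confMetric h hg, eq_weighted_zero h, e]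
  split_ifs
  · simp [flowRhs]
    field_simp
    ring
  · simp

/-- A conformal Ricci flow satisfies `∂v/∂t = v Δv - |∇v|² + 2v²`. -/
theorem IsConformalRicciFlow.hasDerivAt {I : Set ℝ} {v : ℝ → S2 → ℝ}
    (h : IsConformalRicciFlow I v) {t : ℝ} (ht : t ∈ I) (x : S2) :
    HasDerivAt (fun s => v s x)
      (v t x * lap (v t) x - normSq (nabla (ofFun (v t))) x + 2 * v t x ^ 2) t := by
  obtain ⟨w, hw, -⟩ := exists_weighted h.smooth x
  have hf := h.flow t ht x 0 0
  have hpos := h.pos t ht x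
  rw [ricci_weighted (hw t ht) (fun u => (weighted_pos (hw t ht) (h.pos t ht) u).ne')] at hf
  simp only [inCoord_confMetric_center, if_true] at hf
  have hi := hf.inv (inv_ne_zero hpos.ne')
  have e := flow_weighted (hw t ht) 0
  rw [param_zero] at e
  rw [e]
  refine (hi.congr_deriv ?_).congr_of_eventuallyEq (Filter.Eventually.of_forall fun s => ?_)
  · simp only [lam_zero, flowRhs]
    field_simp
  · simp

theorem IsConformalRicciFlow.hasDerivAt_Q {I : Set ℝ} {v : ℝ → S2 → ℝ} (hI : IsOpen I)
    (h : IsConformalRicciFlow I v) {t : ℝ} (ht : t ∈ I) (x : S2) :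
    HasDerivAt (fun s => Q (v s) x)
      (v t x * lap (Q (v t)) x - 4 * scal (confMetric (v t)) x * Q (v t) x
        - 2 * normSq (gradTerm (v t)) x - (1 / 2) * normSq (hessTerm (v t)) x) t := by
  obtain ⟨w, hw, hs⟩ := exists_weighted h.smooth x
  have hne : ∀ u, w t u ≠ 0 := fun u => (weighted_pos (hw t ht) (h.pos t ht) u).ne'
  have hd : ∀ t ∈ I, ∀ u, HasDerivAt (fun s => w s u) (flowRhs (w t) u) t := by
    intro t ht u
    have h1 := (h.hasDerivAt ht (param x u)).const_mul (ilam u ^ 2)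
    rw [flow_weighted (hw t ht)] at h1
    have hl : ilam u ^ 2 * lam u ^ 2 = 1 := by
      rw [mul_comm, ← mul_pow, lam_mul_ilam_apply, one_pow]
    rw [← mul_assoc, hl, one_mul] at h1
    refine h1.congr_of_eventuallyEq ?_
    filter_upwards [hI.mem_nhds ht] with s hs'
    rw [hw s hs', ← mul_assoc, hl, one_mul]
  -- Three applications reach the third derivatives of `w`, of which `Q` is made.
  have step : ∀ {w w' : ℝ → Smooth}
    (_ : ContDiffOn ℝ ∞ (fun z : ℝ × E2 => w z.1 z.2) (I ×ˢ Set.univ) ∧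
      ∀ t ∈ I, ∀ u, HasDerivAt (fun s => w s u) (w' t u) t) (i : Fin 2),
    ContDiffOn ℝ ∞ (fun z : ℝ × E2 => D i (w z.1) z.2) (I ×ˢ Set.univ) ∧
      ∀ t ∈ I, ∀ u, HasDerivAt (fun s => D i (w s) u) (D i (w' t) u) t :=
    fun hh i => hasDerivAt_D hI hh.1 hh.2 i
  have d1 := fun k => step (w := w) (w' := fun t => flowRhs (w t)) ⟨hs, hd⟩ k
  have d2 := fun j k => step (w := fun t => D k (w t)) (w' := fun t => D k (flowRhs (w t))) (d1 k) j
  have d3 := fun i j k => (step (w := fun t => D j (D k (w t)))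
    (w' := fun t => D j (D k (flowRhs (w t)))) (d2 j k) i).2 t ht 0
  have hre : HasDerivAt (fun s => thirdRe (w s) 0) (thirdRe (flowRhs (w t)) 0) t :=
    (d3 0 0 0).sub ((d3 0 1 1).const_mul 3)
  have him : HasDerivAt (fun s => thirdIm (w s) 0) (thirdIm (flowRhs (w t)) 0) t :=
    ((d3 0 0 1).const_mul 3).sub (d3 1 1 1)
  have hQ : HasDerivAt (fun s => flatQ (w s) 0) (1 / 4 * (flowRhs (w t) 0 *
      (thirdRe (w t) 0 ^ 2 + thirdIm (w t) 0 ^ 2) + w t 0 * (2 * thirdRe (w t) 0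
        * thirdRe (flowRhs (w t)) 0 + 2 * thirdIm (w t) 0 * thirdIm (flowRhs (w t)) 0))) t := by
    have := ((hd t ht 0).mul ((hre.pow 2).add (him.pow 2))).const_mul (1 / 4)
    convert! this using 1
    simp
  rw [scal_confMetric (hw t ht) hne, ← evolution_center (hw t ht) (hne 0)]
  refine hQ.congr_of_eventuallyEq ?_
  filter_upwards [hI.mem_nhds ht] with s hs'
  have := Q_weighted (hw s hs') 0
  rwa [param_zero] at this

theorem normSq_nonneg {k : ℕ} (T : TensorField k) (x : S2) : 0 ≤ normSq T x :=
  Finset.sum_nonneg fun _ _ => sq_nonneg _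

/-! ### The King–Rosenau solution -/

/-- The weighted function of the function `a + c ⟨n, x⟩²` in the stereographic coordinates centred
at `p`: a polynomial of degree four. -/
def rosenauPoly (p n : S2) (a c : ℝ) : Smooth :=
  C a * ilam ^ 2 + C c * (C ⟪axis p 0, (n : E3)⟫ * U 0 + C ⟪axis p 1, (n : E3)⟫ * U 1
    + (C 2 - ilam) * C ⟪(p : E3), (n : E3)⟫) ^ 2

theorem rosenauPoly_spec (p n : S2) (a c : ℝ) (u : E2) :
    a + c * ⟪(n : E3), (param p u : E3)⟫ ^ 2 = lam u ^ 2 * rosenauPoly p n a c u := by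
  have h := lam_mul_ilam_apply u
  have e : ⟪(n : E3), (param p u : E3)⟫ = lam u * (⟪axis p 0, (n : E3)⟫ * u 0
      + ⟪axis p 1, (n : E3)⟫ * u 1 + (2 - ilam u) * ⟪(p : E3), (n : E3)⟫) := by
    rw [real_inner_comm, coe_param, inner_add_left, inner_add_left, real_inner_smul_left,
      real_inner_smul_left, real_inner_smul_left]
    linear_combination ⟪(p : E3), (n : E3)⟫ * h
  rw [e]
  simp [rosenauPoly]
  linear_combination (-a * (lam u * ilam u + 1)) * h

/-- With `thirdIm_rosenauPoly`, this says that `∂_z³` annihilates `rosenauPoly`: it is a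
polynomial of degree two in `z`, with coefficients depending on `z̄`. -/
theorem thirdRe_rosenauPoly (p n : S2) (a c : ℝ) (u : E2) :
    thirdRe (rosenauPoly p n a c) u = 0 := by
  simp [thirdRe, rosenauPoly]
  ring

theorem thirdIm_rosenauPoly (p n : S2) (a c : ℝ) (u : E2) :
    thirdIm (rosenauPoly p n a c) u = 0 := by
  simp [thirdIm, rosenauPoly]
  ring

theorem sum_sq_inner_axis (p n : S2) :
    ⟪axis p 0, (n : E3)⟫ ^ 2 + ⟪axis p 1, (n : E3)⟫ ^ 2 + ⟪(p : E3), (n : E3)⟫ ^ 2 = 1 := by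
  have h := inner_eq_axis p (n : E3) (n : E3)
  rw [inner_coe_self] at h
  linear_combination -h

theorem flowRhs_rosenauPoly (p n : S2) (a c : ℝ) :
    flowRhs (rosenauPoly p n a c) 0 =
      2 * a * (a + c) - 2 * c * (a + c) * ⟪(n : E3), (p : E3)⟫ ^ 2 := by
  have h := sum_sq_inner_axis p n
  rw [real_inner_comm]
  simp [flowRhs, rosenauPoly]
  linear_combination (2 * c * (a + c * ⟪(p : E3), (n : E3)⟫ ^ 2)
    - 4 * c ^ 2 * ⟪(p : E3), (n : E3)⟫ ^ 2) * h

theorem Q_kingRosenau (μ : ℝ) (n : S2) (t : ℝ) (x : S2) : Q (kingRosenau μ n t) x = 0 := by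
  have h := Q_weighted (p := x) (v := kingRosenau μ n t) (fun u => rosenauPoly_spec x n _ _ u) 0
  rw [param_zero] at h
  refine h.trans ?_
  simp [flatQ, thirdRe_rosenauPoly, thirdIm_rosenauPoly]

theorem sinh_neg_of_neg {μ t : ℝ} (hμ : 0 < μ) (ht : t < 0) : Real.sinh (2 * μ * t) < 0 :=
  Real.sinh_neg_iff.2 (by nlinarith)

theorem kingRosenau_pos {μ : ℝ} (hμ : 0 < μ) (n : S2) {t : ℝ} (ht : t < 0) (x : S2) :
    0 < kingRosenau μ n t x := by
  have hs := sinh_neg_of_neg hμ ht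
  have hc := Real.cosh_pos (2 * μ * t)
  have h := sum_sq_inner_axis x n
  have hcs := Real.cosh_sq (2 * μ * t)
  have e : kingRosenau μ n t x = μ * (Real.cosh (2 * μ * t) ^ 2
      - Real.sinh (2 * μ * t) ^ 2 * ⟪(x : E3), (n : E3)⟫ ^ 2)
      / (-Real.sinh (2 * μ * t) * Real.cosh (2 * μ * t)) := by
    rw [kingRosenau, Real.tanh_eq_sinh_div_cosh, real_inner_comm]
    have := hs.ne
    field_simp
    ring
  rw [e]
  have h1 : ⟪(x : E3), (n : E3)⟫ ^ 2 ≤ 1 := by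
    nlinarith [sq_nonneg ⟪axis x 0, (n : E3)⟫, sq_nonneg ⟪axis x 1, (n : E3)⟫]
  have h2 : 0 < Real.cosh (2 * μ * t) ^ 2
      - Real.sinh (2 * μ * t) ^ 2 * ⟪(x : E3), (n : E3)⟫ ^ 2 := by
    nlinarith [mul_le_mul_of_nonneg_left h1 (sq_nonneg (Real.sinh (2 * μ * t)))]
  exact div_pos (mul_pos hμ h2) (mul_pos (neg_pos.2 hs) hc)

theorem hasDerivAt_kingRosenau {μ : ℝ} (hμ : 0 < μ) (n : S2) {t : ℝ} (ht : t < 0) (p : S2) :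
    HasDerivAt (fun s => kingRosenau μ n s p) (flowRhs (rosenauPoly p n
      (-μ * (Real.cosh (2 * μ * t) / Real.sinh (2 * μ * t))) (μ * Real.tanh (2 * μ * t))) 0) t := by
  have hs := (sinh_neg_of_neg hμ ht).ne
  have hc := (Real.cosh_pos (2 * μ * t)).ne'
  have hl : HasDerivAt (fun s => 2 * μ * s) (2 * μ) t := by
    simpa using (hasDerivAt_id t).const_mul (2 * μ)
  have h1 := ((hl.cosh.div hl.sinh hs).const_mul (-μ)).add
    (((hl.sinh.div hl.cosh hc).const_mul μ).mul_const (⟪(n : E3), (p : E3)⟫ ^ 2))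
  refine (h1.congr_deriv ?_).congr_of_eventuallyEq (Filter.Eventually.of_forall fun s => ?_)
  · rw [flowRhs_rosenauPoly, Real.tanh_eq_sinh_div_cosh]
    generalize ⟪(n : E3), (p : E3)⟫ = r
    generalize Real.cosh (2 * μ * t) = c at *
    generalize Real.sinh (2 * μ * t) = s at *
    field_simp
    ring
  · simp [kingRosenau, Real.tanh_eq_sinh_div_cosh]

theorem contMDiffOn_kingRosenau {μ : ℝ} (hμ : 0 < μ) (n : S2) :
    ContMDiffOn (𝓘(ℝ, ℝ).prod (𝓡 2)) 𝓘(ℝ, ℝ) ∞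
      (fun z : ℝ × S2 => kingRosenau μ n z.1 z.2) (Set.Iio 0 ×ˢ Set.univ) := by
  have hl : ContDiff ℝ ∞ fun t : ℝ => 2 * μ * t := by fun_prop
  have hc : ContDiff ℝ ∞ fun t : ℝ => Real.cosh (2 * μ * t) := Real.contDiff_cosh.comp hl
  have hs : ContDiff ℝ ∞ fun t : ℝ => Real.sinh (2 * μ * t) := Real.contDiff_sinh.comp hl
  have h1 : ContDiffOn ℝ ∞ (fun t : ℝ => -μ * (Real.cosh (2 * μ * t) / Real.sinh (2 * μ * t)))
      (Set.Iio 0) :=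
    contDiffOn_const.mul (hc.contDiffOn.div hs.contDiffOn fun t ht => (sinh_neg_of_neg hμ ht).ne)
  have h2 : ContDiff ℝ ∞ (fun t : ℝ => μ * Real.tanh (2 * μ * t)) := by
    simp only [Real.tanh_eq_sinh_div_cosh]
    exact contDiff_const.mul (hs.div hc fun t => (Real.cosh_pos _).ne')
  have h3 : ContMDiff (𝓡 2) 𝓘(ℝ, ℝ) ∞ (fun x : S2 => ⟪(n : E3), (x : E3)⟫) := by
    have := fact_finrank_E3
    exact (innerSL ℝ (n : E3)).contDiff.contMDiff.comp contMDiff_coe_sphere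
  have h1' : ContMDiffOn (𝓘(ℝ, ℝ).prod (𝓡 2)) 𝓘(ℝ, ℝ) ∞ (fun z : ℝ × S2 =>
      -μ * (Real.cosh (2 * μ * z.1) / Real.sinh (2 * μ * z.1))) (Set.Iio 0 ×ˢ Set.univ) :=
    h1.contMDiffOn.comp contMDiffOn_fst fun z hz => hz.1
  have h2' : ContMDiff (𝓘(ℝ, ℝ).prod (𝓡 2)) 𝓘(ℝ, ℝ) ∞ (fun z : ℝ × S2 =>
      μ * Real.tanh (2 * μ * z.1)) := h2.contMDiff.comp contMDiff_fst
  have h3' : ContMDiff (𝓘(ℝ, ℝ).prod (𝓡 2)) 𝓘(ℝ, ℝ) ∞ (fun z : ℝ × S2 =>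
      ⟪(n : E3), (z.2 : E3)⟫ ^ 2) := (h3.comp contMDiff_snd).pow 2
  exact h1'.add (h2'.mul h3').contMDiffOn

theorem isConformalRicciFlow_kingRosenau {μ : ℝ} (hμ : 0 < μ) (n : S2) :
    IsConformalRicciFlow (Set.Iio 0) (kingRosenau μ n) where
  pos t ht x := kingRosenau_pos hμ n ht x
  smooth := contMDiffOn_kingRosenau hμ n
  flow t ht p i j := by
    have hw : ∀ u, kingRosenau μ n t (param p u) = lam u ^ 2 * rosenauPoly p n
      (-μ * (Real.cosh (2 * μ * t) / Real.sinh (2 * μ * t))) (μ * Real.tanh (2 * μ * t)) u :=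
      fun u => rosenauPoly_spec p n _ _ u
    have hpos := fun x => kingRosenau_pos hμ n ht x
    rw [ricci_weighted hw fun u => (weighted_pos hw hpos u).ne']
    simp only [inCoord_confMetric_center]
    split_ifs
    · exact (hasDerivAt_kingRosenau hμ n ht p).inv (hpos p).ne'
    · exact hasDerivAt_const t 0

end SphereFlow

end

theorem mainTheorem1 :
    (∀ (I : Set ℝ) (v : ℝ → S2 → ℝ), IsOpen I → IsConformalRicciFlow I v →
      ∀ t ∈ I, ∀ x : S2,
        HasDerivAt (fun s => Q (v s) x)
          (v t x * lap (Q (v t)) x - 4 * scal (confMetric (v t)) x * Q (v t) x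
            - 2 * normSq (gradTerm (v t)) x - (1 / 2) * normSq (hessTerm (v t)) x) t ∧
        deriv (fun s => Q (v s) x) t ≤
          v t x * lap (Q (v t)) x - 4 * scal (confMetric (v t)) x * Q (v t) x) ∧
    (∀ (μ : ℝ) (n : S2), 0 < μ →
      IsConformalRicciFlow (Set.Iio 0) (kingRosenau μ n) ∧
      ∀ t < 0, ∀ x : S2, Q (kingRosenau μ n t) x = 0) := by
  refine ⟨fun I v hI h t ht x => ?_, fun μ n hμ =>
    ⟨isConformalRicciFlow_kingRosenau hμ n, fun t _ x => Q_kingRosenau μ n t x⟩⟩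
  have hQ := h.hasDerivAt_Q hI ht x
  refine ⟨hQ, ?_⟩
  rw [hQ.deriv]
  have h1 := normSq_nonneg (gradTerm (v t)) x
  have h2 := normSq_nonneg (hessTerm (v t)) x
  linarith
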